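/- There are absolute constants $c, C, \kappa > 0$ such that the following holds. Let $n, m \ge 0$ be integers, let $\Theta \in \mathbb{R}^{n\times n}$ be a symmetric positive semidefinite matrix that has a nonzero eigenvalue, and let $\lambda$ be its minimum nonzero eigenvalue. Let $\epsilon, \delta, \eta, \tau > 0$ be real numbers and let $\tilde\Theta = \Theta + \epsilon I$. Suppose that $m \ge C \log n$, that $\epsilon \le c\,\delta^2 \lambda / n$, that $r := \dim\ker\Theta > 2m$, and that $\ker\Theta$ is $(\delta,\eta,\tau)$-quantitatively dense, i.e. for every set $S \subseteq [n]$ with $|S| \le \tau$ and every $x \in \mathbb{R}^n$ with $\mathrm{dist}(x, \ker\Theta) = \inf_{v\in\ker\Theta}\|x-v\|_2 \le \delta \|x\|_2$, one has $\|x_{[n]\setminus S}\|_2 \ge \eta \|x\|_2$. (Here $x_U \in \mathbb{R}^U$ denotes the restriction of $x$ to the coordinates in $U \subseteq [n]$.) Fix $u \in \mathbb{R}^n$ and $P \subseteq [n]$ with $|P| \ge n - \tau$. Let $X_1,\dots,X_m \sim N(0, \tilde\Theta^{-1})$ be independent and let $X$ be the $m \times n$ matrix with rows $X_1,\dots,X_m$.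 Then $$\Pr\left[\ \inf_{a \in \mathbb{R}^m} \|u_P - (X^T a)_P\|_2 \ \ge\ \frac{\eta}{32}\,\|u_P\|_2\ \right]\ \ge\ 1 - \frac{4m}{3r} - \exp(-\kappa m).$$ -/

import Mathlib

open MeasureTheory ProbabilityTheory

/-- The restriction `x_U` of a vector `x ∈ ℝⁿ` to the coordinates in `U ⊆ [n]`,
a vector of `ℝ^U` (with its Euclidean norm). -/
def coordRestrict {n : ℕ} (U : Finset (Fin n)) (x : EuclideanSpace ℝ (Fin n)) :
    EuclideanSpace ℝ U :=
  WithLp.toLp 2 (fun i : U => x i)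

/-- A subspace `V ⊆ ℝⁿ` is `(δ, η, τ)`-quantitatively dense if every `x` with
`dist(x, V) ≤ δ ‖x‖₂` satisfies `‖x_{Cᶜ}‖₂ ≥ η ‖x‖₂` for all `C ⊆ [n]` with `|C| ≤ τ`. -/
def IsQuantitativelyDense {n : ℕ} (V : Submodule ℝ (EuclideanSpace ℝ (Fin n)))
    (δ η τ : ℝ) : Prop :=
  ∀ C : Finset (Fin n), (C.card : ℝ) ≤ τ →
    ∀ x : EuclideanSpace ℝ (Fin n),
      Metric.infDist x (V : Set (EuclideanSpace ℝ (Fin n))) ≤ δ * ‖x‖ →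
        η * ‖x‖ ≤ ‖coordRestrict Cᶜ x‖

/-- The kernel of a matrix, as a subspace of Euclidean space. -/
noncomputable def euclideanKer {n : ℕ} (Θ : Matrix (Fin n) (Fin n) ℝ) :
    Submodule ℝ (EuclideanSpace ℝ (Fin n)) :=
  LinearMap.ker (Matrix.toEuclideanLin Θ)

/-- `lam` is the minimum nonzero eigenvalue of `Θ` (in particular there is one). -/
def IsMinNonzeroEigenvalue {n : ℕ} (Θ : Matrix (Fin n) (Fin n) ℝ) (lam : ℝ) : Prop :=
  IsLeast {μ : ℝ | μ ≠ 0 ∧ Module.End.HasEigenvalue (Matrix.toEuclideanLin Θ) μ} lam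

/-- The `m × n` matrix whose rows are the samples `X 0, …, X (m - 1)`. -/
def designMatrix {m n : ℕ} (X : Fin m → EuclideanSpace ℝ (Fin n)) :
    Matrix (Fin m) (Fin n) ℝ :=
  Matrix.of fun i j => X i j

/-- The joint law of `m` independent samples from `N(0, S)` in `ℝⁿ`. -/
noncomputable def gaussianSamples (m : ℕ) {n : ℕ} (S : Matrix (Fin n) (Fin n) ℝ) :
    Measure (Fin m → EuclideanSpace ℝ (Fin n)) :=
  Measure.pi fun _ : Fin m => multivariateGaussian 0 S

/-! In the eigenbasis of `Θ` a sample has independent Gaussian coordinates with standard deviations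
`σ i = (μ i + ε)^(-1/2)`. The kernel directions have the largest variance, `1/ε`, and every other
direction has variance at most `1/lam`. Two random events then reduce the theorem to geometry.

(1) A fixed vector `z` stays at distance at least `‖z‖/2` from the span of the samples, except with
probability `4m/(3r)`. By sign symmetry the expected projection onto the span is diagonal in the
eigenbasis; its diagonal entries sum to at most `m` and are largest on the `r` kernel directions, so
each is at most `m/r`. Markov's inequality concludes (`integral_projEnergy_le`,
`exists_close_scaledComb_le`).

(2) Except with probability `e^(-m)`, every combination of the unscaled rows has energy off the
kernel at most `O(n)` times its energy on it (`gaussianMatrix_energy_ratio`). Each row restricted to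
the kernel is far from the span of the others, which bounds the inverse of the kernel block; the
independent remaining block is then controlled in Frobenius norm. After scaling, the ratio gains a
factor `ε/lam`, so every vector of the span lies within `δ/48` of the kernel, relative to its norm.

The geometric step (`IsQuantitativelyDense.exists_test_vector`) takes `z` in the kernel whose
restriction to `P` is the projection of `u_P` onto the restricted kernel. If `x` is near the kernel
and far from `z`, density makes `(z - x)_P` large, while `u_P - z_P` is orthogonal to the restricted
kernel, so no cancellation can bring `x_P` close to `u_P`. -/

open scoped RealInnerProductSpace

/-! ### Gaussian matrices: transposition, exponential moments, linear combinations. -/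

section GaussianTools

/-- The law of a matrix with independent standard Gaussian entries. -/
noncomputable def gaussianMatrix (κ ι : Type*) [Fintype κ] [Fintype ι] : Measure (κ → ι → ℝ) :=
  Measure.pi fun _ : κ => Measure.pi fun _ : ι => gaussianReal 0 1

instance {κ ι : Type*} [Fintype κ] [Fintype ι] : IsProbabilityMeasure (gaussianMatrix κ ι) := by
  unfold gaussianMatrix; infer_instance

theorem map_uncurry_gaussianMatrix (κ ι : Type*) [Fintype κ] [Fintype ι] :
    (gaussianMatrix κ ι).map (fun g (p : κ × ι) => g p.1 p.2)
      = Measure.pi fun _ => gaussianReal 0 1 := by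
  refine (Measure.pi_eq fun s hs => ?_).symm
  rw [Measure.map_apply (by fun_prop) (MeasurableSet.univ_pi hs)]
  have : (fun (g : κ → ι → ℝ) (p : κ × ι) => g p.1 p.2) ⁻¹' Set.univ.pi s
      = Set.univ.pi fun k => Set.univ.pi fun i => s (k, i) := by
    ext g; simp [Set.mem_pi]
  rw [this, gaussianMatrix, Measure.pi_pi]
  simp_rw [Measure.pi_pi]
  rw [Fintype.prod_prod_type]

theorem measurePreserving_swap_gaussianMatrix (κ ι : Type*) [Fintype κ] [Fintype ι] :
    MeasurePreserving (fun (g : κ → ι → ℝ) i k => g k i)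
      (gaussianMatrix κ ι) (gaussianMatrix ι κ) := by
  refine ⟨by fun_prop, ?_⟩
  have h1 : (gaussianMatrix κ ι).map (fun (g : κ → ι → ℝ) i k => g k i)
      = ((gaussianMatrix κ ι).map (fun g (p : κ × ι) => g p.1 p.2)).map
        (fun f i k => f (k, i)) := by
    rw [Measure.map_map (by fun_prop) (by fun_prop)]; rfl
  have h2 : gaussianMatrix ι κ
      = ((gaussianMatrix ι κ).map (fun g (p : ι × κ) => g p.1 p.2)).map
        (fun f i k => f (i, k)) := by
    rw [Measure.map_map (by fun_prop) (by fun_prop)]; exact Measure.map_id.symm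
  rw [h1, h2, map_uncurry_gaussianMatrix, map_uncurry_gaussianMatrix]
  have h3 : (Measure.pi fun _ : ι × κ => gaussianReal 0 1).map
      (fun f (p : κ × ι) => f p.swap) = Measure.pi fun _ : κ × ι => gaussianReal 0 1 := by
    refine (Measure.pi_eq fun s hs => ?_).symm
    rw [Measure.map_apply (by fun_prop) (MeasurableSet.univ_pi hs)]
    have : (fun (f : ι × κ → ℝ) (p : κ × ι) => f p.swap) ⁻¹' Set.univ.pi s
        = Set.univ.pi fun q => s q.swap := by
      ext g; simp only [Set.mem_preimage, Set.mem_univ_pi, Prod.forall, Prod.swap_prod_mk]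
      exact forall_comm
    rw [this, Measure.pi_pi]
    exact Fintype.prod_equiv (Equiv.prodComm ι κ) _ _ fun _ => rfl
  rw [← h3, Measure.map_map (by fun_prop) (by fun_prop)]
  rfl

theorem integral_exp_mul_sq_gaussianReal {s : ℝ} (hs : s < 1 / 2) :
    ∫ x, Real.exp (s * x ^ 2) ∂gaussianReal 0 1 = (√(1 - 2 * s))⁻¹ := by
  rw [integral_gaussianReal_eq_integral_smul one_ne_zero]
  have : ∀ x : ℝ, gaussianPDFReal 0 1 x • Real.exp (s * x ^ 2)
      = (√(2 * Real.pi))⁻¹ * Real.exp (-(1 / 2 - s) * x ^ 2) := by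
    intro x
    simp only [gaussianPDFReal, NNReal.coe_one, mul_one, sub_zero, smul_eq_mul]
    rw [mul_assoc, ← Real.exp_add]; congr 2; ring
  simp_rw [this]
  rw [integral_const_mul, integral_gaussian, ← Real.sqrt_inv, ← Real.sqrt_inv,
    ← Real.sqrt_mul (by positivity)]
  congr 1
  have : (1 / 2 - s) ≠ 0 := by linarith
  have : (1 - 2 * s) ≠ 0 := by linarith
  field_simp

theorem integrable_exp_mul_sq_gaussianReal {s : ℝ} (hs : s < 1 / 2) :
    Integrable (fun x => Real.exp (s * x ^ 2)) (gaussianReal 0 1) := by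
  by_contra h
  have h1 := integral_exp_mul_sq_gaussianReal hs
  rw [integral_undef h] at h1
  have : 0 < (√(1 - 2 * s))⁻¹ := by
    have : 0 < 1 - 2 * s := by linarith
    positivity
  linarith

theorem integral_exp_mul_sum_sq {ι : Type*} [Fintype ι] {s : ℝ} (hs : s < 1 / 2) :
    ∫ x : ι → ℝ, Real.exp (s * ∑ i, x i ^ 2) ∂(Measure.pi fun _ => gaussianReal 0 1)
      = (√(1 - 2 * s))⁻¹ ^ Fintype.card ι := by
  simp_rw [Finset.mul_sum, Real.exp_sum]
  rw [integral_fintype_prod_eq_pow (fun x : ℝ => Real.exp (s * x ^ 2)),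
    integral_exp_mul_sq_gaussianReal hs]

theorem integrable_exp_mul_sum_sq {ι : Type*} [Fintype ι] {s : ℝ} (hs : s < 1 / 2) :
    Integrable (fun x : ι → ℝ => Real.exp (s * ∑ i, x i ^ 2))
      (Measure.pi fun _ => gaussianReal 0 1) := by
  simp_rw [Finset.mul_sum, Real.exp_sum]
  exact Integrable.fintype_prod (f := fun _ x => Real.exp (s * x ^ 2))
    fun _ => integrable_exp_mul_sq_gaussianReal hs

/-- The characteristic function factors over the coordinates, and the variances `a k ^ 2` add up to
one. -/
theorem map_sum_mul_pi_gaussianReal {κ : Type*} [Fintype κ] (a : κ → ℝ) (ha : ∑ k, a k ^ 2 = 1) :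
    (Measure.pi fun _ : κ => gaussianReal 0 1).map (fun x => ∑ k, a k * x k)
      = gaussianReal 0 1 := by
  have := Measure.isProbabilityMeasure_map (μ := Measure.pi fun _ : κ => gaussianReal 0 1)
    (f := fun x => ∑ k, a k * x k) (Measurable.aemeasurable (by fun_prop))
  apply Measure.ext_of_charFun
  ext t
  rw [charFun_apply_real, integral_map (Measurable.aemeasurable (by fun_prop))
    (Measurable.aestronglyMeasurable (by fun_prop))]
  simp only [Complex.ofReal_sum, Complex.ofReal_mul, Finset.mul_sum, Finset.sum_mul,
    Complex.exp_sum]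
  rw [integral_fintype_prod_eq_prod (f := fun k (x : ℝ) => Complex.exp (t * (a k * x) * Complex.I))]
  have : ∀ k, ∫ x : ℝ, Complex.exp (t * (a k * x) * Complex.I) ∂gaussianReal 0 1
      = Complex.exp (-((t * a k) ^ 2 / 2)) := by
    intro k
    have := charFun_gaussianReal (μ := 0) (v := 1) (t * a k)
    rw [charFun_apply_real] at this
    simp only [Complex.ofReal_mul, ← mul_assoc] at this ⊢
    rw [this]; congr 1; simp
  simp_rw [this]
  rw [← Complex.exp_sum, charFun_gaussianReal]
  congr 1
  have h : ((∑ k, a k ^ 2 : ℝ) : ℂ) = 1 := by rw [ha]; simp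
  push_cast at h
  simp only [mul_pow, Finset.sum_neg_distrib, ← Finset.sum_div, ← Finset.mul_sum, h]
  simp

end GaussianTools

/-! ### Lower tail for the distance from a Gaussian row to the span of the others. -/

section SmallBall

/-- The characteristic function of the image at `t` is that of the source at the adjoint applied to
`t`, and for a standard Gaussian it depends only on the norm. The intended case is an orthogonal
projection onto a subspace, whose adjoint is the inclusion. -/
theorem map_stdGaussian_of_isometry_adjoint {E F : Type*} [NormedAddCommGroup E]
    [InnerProductSpace ℝ E] [FiniteDimensional ℝ E] [MeasurableSpace E] [BorelSpace E]
    [NormedAddCommGroup F] [InnerProductSpace ℝ F] [FiniteDimensional ℝ F] [MeasurableSpace F]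
    [BorelSpace F] (L : E →L[ℝ] F) (hL : ∀ t, ‖ContinuousLinearMap.adjoint L t‖ = ‖t‖) :
    (stdGaussian E).map L = stdGaussian F := by
  have := Measure.isProbabilityMeasure_map (μ := stdGaussian E) (f := L) (by fun_prop)
  apply Measure.ext_of_charFun
  ext t
  rw [charFun_apply, integral_map (by fun_prop) (by fun_prop)]
  simp_rw [← ContinuousLinearMap.adjoint_inner_right L]
  rw [← charFun_apply, charFun_stdGaussian, charFun_stdGaussian, hL]

theorem integral_exp_mul_norm_sq_stdGaussian {E : Type*} [NormedAddCommGroup E]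
    [InnerProductSpace ℝ E] [FiniteDimensional ℝ E] [MeasurableSpace E] [BorelSpace E] {s : ℝ}
    (hs : s < 1 / 2) :
    ∫ x, Real.exp (s * ‖x‖ ^ 2) ∂stdGaussian E = (√(1 - 2 * s))⁻¹ ^ Module.finrank ℝ E := by
  have h : ∀ x : Fin (Module.finrank ℝ E) → ℝ,
      ‖∑ i, x i • stdOrthonormalBasis ℝ E i‖ ^ 2 = ∑ i, x i ^ 2 := by
    intro x
    rw [← (stdOrthonormalBasis ℝ E).sum_sq_inner_right]
    simp [inner_sum, inner_smul_right, orthonormal_iff_ite.1 (stdOrthonormalBasis ℝ E).orthonormal]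
  rw [stdGaussian, integral_map (Measurable.aemeasurable (by fun_prop)) (by fun_prop)]
  simp_rw [h]
  rw [integral_exp_mul_sum_sq hs, Fintype.card_fin]

theorem integral_exp_mul_norm_sq_orthogonal_stdGaussian {E : Type*} [NormedAddCommGroup E]
    [InnerProductSpace ℝ E] [FiniteDimensional ℝ E] [MeasurableSpace E] [BorelSpace E]
    (U : Submodule ℝ E) {s : ℝ} (hs : s < 1 / 2) :
    ∫ x, Real.exp (s * ‖Uᗮ.starProjection x‖ ^ 2) ∂stdGaussian E
      = (√(1 - 2 * s))⁻¹ ^ Module.finrank ℝ Uᗮ := by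
  rw [← integral_exp_mul_norm_sq_stdGaussian hs,
    ← map_stdGaussian_of_isometry_adjoint (Uᗮ.orthogonalProjectionOnto),
    integral_map (by fun_prop) (by fun_prop)]
  · rfl
  · intro t
    rw [Submodule.adjoint_orthogonalProjectionOnto]; rfl

/-- The constant of the small ball estimate for a Gaussian vector and a subspace. -/
noncomputable def smallBallConst : ℝ := 2 * Real.exp (-12)

theorem stdGaussian_norm_starProjection_orthogonal_le {ι : Type*} [Fintype ι] (U : Submodule ℝ (EuclideanSpace ℝ ι))
    (hU : 2 * Module.finrank ℝ U ≤ Fintype.card ι) :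
    (stdGaussian (EuclideanSpace ℝ ι)).real
      {x | ‖Uᗮ.starProjection x‖ ^ 2 ≤ smallBallConst * Fintype.card ι}
        ≤ Real.exp (-2 * Fintype.card ι) := by
  set r := Fintype.card ι
  have hs : -(1 / smallBallConst) < 1 / 2 := by
    have : 0 < smallBallConst := by unfold smallBallConst; positivity
    have : 0 < 1 / smallBallConst := by positivity
    linarith
  have hI := integral_exp_mul_norm_sq_orthogonal_stdGaussian U hs
  have hint : Integrable (fun x => Real.exp (-(1 / smallBallConst) * ‖Uᗮ.starProjection x‖ ^ 2))
      (stdGaussian (EuclideanSpace ℝ ι)) := by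
    refine Integrable.of_bound (by fun_prop) 1 (.of_forall fun x => ?_)
    rw [Real.norm_eq_abs, Real.abs_exp, Real.exp_le_one_iff]
    have : 0 ≤ 1 / smallBallConst * ‖Uᗮ.starProjection x‖ ^ 2 := by
      unfold smallBallConst; positivity
    linarith
  have h := measure_le_le_exp_mul_mgf (μ := stdGaussian (EuclideanSpace ℝ ι))
    (X := fun x => ‖Uᗮ.starProjection x‖ ^ 2) (smallBallConst * r) (t := -(1 / smallBallConst))
    (by have : 0 < 1 / smallBallConst := by unfold smallBallConst; positivity
        linarith) hint
  refine h.trans ?_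
  rw [mgf, hI]
  have hd : r ≤ 2 * Module.finrank ℝ Uᗮ := by
    have := U.finrank_add_finrank_orthogonal
    rw [finrank_euclideanSpace] at this
    omega
  -- The value `2e^(-12)` makes `1 + 2/smallBallConst = 1 + e^12`, so each of the at least `r/2`
  -- dimensions of `Uᗮ` contributes a factor at most `e^(-6)`. This beats the Chernoff factor `e^r`
  -- and leaves `e^(-2r)`.
  have h1 : (√(1 - 2 * -(1 / smallBallConst)))⁻¹ ≤ Real.exp (-6) := by
    rw [← Real.sqrt_inv]
    apply Real.sqrt_le_iff.2 ⟨(Real.exp_pos _).le, ?_⟩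
    rw [← Real.exp_nat_mul]
    refine inv_le_of_inv_le₀ (Real.exp_pos _) ?_
    rw [← Real.exp_neg, smallBallConst]
    have : 2 * -(1 / (2 * Real.exp (-12))) = -Real.exp 12 := by
      rw [Real.exp_neg]; field_simp
    rw [this]; norm_num
  have h2 : -(-(1 / smallBallConst)) * (smallBallConst * r) = r := by
    have : smallBallConst ≠ 0 := by unfold smallBallConst; positivity
    field_simp
  rw [h2]
  calc Real.exp r * (√(1 - 2 * -(1 / smallBallConst)))⁻¹ ^ Module.finrank ℝ Uᗮ
      ≤ Real.exp r * Real.exp (-6) ^ Module.finrank ℝ Uᗮ := by gcongr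
    _ = Real.exp (r - 6 * Module.finrank ℝ Uᗮ) := by
        rw [← Real.exp_nat_mul, ← Real.exp_add]; congr 1; ring
    _ ≤ _ := by
        apply Real.exp_le_exp.2
        have : (r : ℝ) ≤ 2 * Module.finrank ℝ Uᗮ := by exact_mod_cast hd
        linarith

theorem smallBallConst_pos : 0 < smallBallConst := by unfold smallBallConst; positivity

/-- Condition on the rows other than `i`, which span a subspace `U` of dimension at most `d`. A
combination with `a i = 1` has the same component in `Uᗮ` as row `i`, and row `i` is independent of
`U`. -/
theorem gaussian_row_close_to_span_le {d : ℕ} {ι : Type*} [Fintype ι]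
    (hd : 2 * (d + 1) ≤ Fintype.card ι) (i : Fin (d + 1)) :
    (gaussianMatrix (Fin (d + 1)) ι).real
      {g | ∃ a : Fin (d + 1) → ℝ, a i = 1 ∧
        ∑ j, (∑ k, a k * g k j) ^ 2 < smallBallConst * Fintype.card ι}
      ≤ Real.exp (-2 * Fintype.card ι) := by
  set S := {g : Fin (d + 1) → ι → ℝ | ∃ a : Fin (d + 1) → ℝ, a i = 1 ∧
        ∑ j, (∑ k, a k * g k j) ^ 2 < smallBallConst * Fintype.card ι} with hS
  have hSo : IsOpen S := by
    have : S = ⋃ a : {a : Fin (d + 1) → ℝ // a i = 1}, {g | ∑ j, (∑ k, a.1 k * g k j) ^ 2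
        < smallBallConst * Fintype.card ι} := by
      ext g; simp [hS]
    rw [this]
    exact isOpen_iUnion fun a => isOpen_lt (by fun_prop) (by fun_prop)
  have hmp := (measurePreserving_piFinSuccAbove
    (fun _ : Fin (d + 1) => Measure.pi fun _ : ι => gaussianReal 0 1) i).symm
  rw [measureReal_def]
  refine ENNReal.toReal_le_of_le_ofReal (Real.exp_pos _).le ?_
  rw [gaussianMatrix, ← hmp.measure_preimage hSo.measurableSet.nullMeasurableSet,
    Measure.prod_apply_symm (hmp.measurable hSo.measurableSet)]
  refine (lintegral_mono (g := fun _ => ENNReal.ofReal (Real.exp (-2 * Fintype.card ι)))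
    fun h => ?_).trans (by simp)
  set U : Submodule ℝ (EuclideanSpace ℝ ι) :=
    Submodule.span ℝ (Set.range fun k : Fin d => (WithLp.toLp 2 (h k) : EuclideanSpace ℝ ι))
  have hU : Module.finrank ℝ U ≤ d := by
    exact (finrank_range_le_card (R := ℝ)
      (fun k : Fin d => (WithLp.toLp 2 (h k) : EuclideanSpace ℝ ι))).trans (by simp)
  have hsub : (fun x => (x, h)) ⁻¹' ((MeasurableEquiv.piFinSuccAbove
      (fun _ : Fin (d + 1) => ι → ℝ) i).symm ⁻¹' S) ⊆
      (WithLp.toLp 2) ⁻¹' {x : EuclideanSpace ℝ ι |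
        ‖Uᗮ.starProjection x‖ ^ 2 ≤ smallBallConst * Fintype.card ι} := by
    rintro x ⟨a, ha, hlt⟩
    refine le_trans ?_ hlt.le
    have hz : (WithLp.toLp 2 (fun j => ∑ k, a k *
        (MeasurableEquiv.piFinSuccAbove (fun _ : Fin (d + 1) => ι → ℝ) i).symm (x, h) k j)
          : EuclideanSpace ℝ ι)
        = WithLp.toLp 2 x + ∑ k : Fin d, a (i.succAbove k) • WithLp.toLp 2 (h k) := by
      ext j
      simp [Fin.sum_univ_succAbove _ i, ha, MeasurableEquiv.piFinSuccAbove,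
        Fin.insertNthEquiv]
    have hm : ∑ k : Fin d, a (i.succAbove k) • (WithLp.toLp 2 (h k) : EuclideanSpace ℝ ι) ∈ U :=
      Submodule.sum_mem _ fun k _ => Submodule.smul_mem _ _ (Submodule.subset_span ⟨k, rfl⟩)
    have h0 : Uᗮ.starProjection (WithLp.toLp 2 x : EuclideanSpace ℝ ι)
        = Uᗮ.starProjection (WithLp.toLp 2 x +
          ∑ k : Fin d, a (i.succAbove k) • WithLp.toLp 2 (h k)) := by
      rw [map_add, (Submodule.starProjection_apply_eq_zero_iff _).2
        (U.le_orthogonal_orthogonal hm), add_zero]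
    rw [h0, ← hz]
    calc _ ≤ ‖(WithLp.toLp 2 (fun j => ∑ k, a k *
        (MeasurableEquiv.piFinSuccAbove (fun _ : Fin (d + 1) => ι → ℝ) i).symm (x, h) k j)
          : EuclideanSpace ℝ ι)‖ ^ 2 := by
            gcongr; exact Submodule.norm_starProjection_apply_le _ _
      _ = _ := by rw [EuclideanSpace.real_norm_sq_eq]
  refine (measure_mono hsub).trans ?_
  have hmeas : MeasurableSet {x : EuclideanSpace ℝ ι |
        ‖Uᗮ.starProjection x‖ ^ 2 ≤ smallBallConst * Fintype.card ι} :=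
    measurableSet_le (by fun_prop) (by fun_prop)
  rw [← Measure.map_apply (by fun_prop) hmeas, map_pi_eq_stdGaussian,
    ← ofReal_measureReal]
  exact ENNReal.ofReal_le_ofReal (stdGaussian_norm_starProjection_orthogonal_le U (by omega))

end SmallBall

/-! ### Upper tail for the Frobenius norm of a fixed matrix times a Gaussian one. -/

section UpperTail

theorem integral_exp_mul_sum_sq_linearComb {J κ : Type*} [Fintype J] [Fintype κ] (a : κ → ℝ)
    (ha : ∑ k, a k ^ 2 = 1) {s : ℝ} (hs : s < 1 / 2) :
    ∫ h : J → κ → ℝ, Real.exp (s * ∑ j, (∑ l, a l * h j l) ^ 2) ∂gaussianMatrix J κ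
      = (√(1 - 2 * s))⁻¹ ^ Fintype.card J ∧
    Integrable (fun h : J → κ → ℝ => Real.exp (s * ∑ j, (∑ l, a l * h j l) ^ 2))
      (gaussianMatrix J κ) := by
  have hmap : (gaussianMatrix J κ).map (fun h j => ∑ l, a l * h j l)
      = Measure.pi fun _ => gaussianReal 0 1 := by
    have : IsProbabilityMeasure
        ((Measure.pi fun _ : κ => gaussianReal 0 1).map (fun x => ∑ k, a k * x k)) := by
      rw [map_sum_mul_pi_gaussianReal a ha]; infer_instance
    have h := Measure.pi_map_pi (ι := J) (μ := fun _ => Measure.pi fun _ : κ => gaussianReal 0 1)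
      (f := fun _ (x : κ → ℝ) => ∑ l, a l * x l) (fun _ => Measurable.aemeasurable (by fun_prop))
    simp_rw [map_sum_mul_pi_gaussianReal a ha] at h
    exact h
  constructor
  · rw [← integral_exp_mul_sum_sq hs, ← hmap,
      integral_map (Measurable.aemeasurable (by fun_prop))
        (Measurable.aestronglyMeasurable (by fun_prop))]
  · have := integrable_exp_mul_sum_sq (ι := J) hs
    rw [← hmap, integrable_map_measure (Measurable.aestronglyMeasurable (by fun_prop))
        (Measurable.aemeasurable (by fun_prop))] at this
    exact this

theorem exists_unit_direction {κ : Type*} [Fintype κ] [Nonempty κ] (a : κ → ℝ) :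
    ∃ b : κ → ℝ, ∑ k, b k ^ 2 = 1 ∧ ∀ k, a k = √(∑ k, a k ^ 2) * b k := by
  classical
  have h0 : 0 ≤ ∑ k, a k ^ 2 := by positivity
  rcases h0.eq_or_lt with h | h
  · obtain ⟨k₀⟩ := ‹Nonempty κ›
    refine ⟨Pi.single k₀ 1, ?_, fun k => ?_⟩
    · rw [Finset.sum_eq_single k₀] <;> simp +contextual
    · have := (Finset.sum_eq_zero_iff_of_nonneg (fun k _ => sq_nonneg (a k))).1 h.symm k
        (Finset.mem_univ k)
      rw [← h]; simpa using this
  · have hp : 0 < √(∑ k, a k ^ 2) := Real.sqrt_pos.2 h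
    refine ⟨fun k => a k / √(∑ k, a k ^ 2), ?_, fun k => by field_simp⟩
    simp_rw [div_pow, ← Finset.sum_div, Real.sq_sqrt h0]
    exact div_self h.ne'

/-- Upper tail bound for the Frobenius norm of `A` times a Gaussian matrix. -/
theorem gaussianMatrix_sum_sq_mul_le {J κ τ : Type*} [Fintype J] [Fintype κ] [Fintype τ]
    (A : τ → κ → ℝ) {T : ℝ} (hT : ∑ k, ∑ l, A k l ^ 2 ≤ T) (hT0 : 0 < T) {N : ℕ}
    (hN : Fintype.card J ≤ N) :
    (gaussianMatrix J κ).real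
      {h | 8 * T * N < ∑ k, ∑ j, (∑ l, A k l * h j l) ^ 2} ≤ Real.exp (-(N : ℝ)) := by
  rcases isEmpty_or_nonempty κ with hκ | hκ
  · have : {h : J → κ → ℝ | 8 * T * N < ∑ k, ∑ j, (∑ l, A k l * h j l) ^ 2} = ∅ := by
      ext h; simp; positivity
    rw [this]; simp; positivity
  set P : τ → ℝ := fun k => ∑ l, A k l ^ 2 with hP
  have hP0 : ∀ k, 0 ≤ P k := fun k => by simp only [hP]; positivity
  choose B hB1 hB2 using fun k => exists_unit_direction (A k)
  set Z : τ → (J → κ → ℝ) → ℝ := fun k h => ∑ j, (∑ l, B k l * h j l) ^ 2 with hZ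
  have hAZ : ∀ (h : J → κ → ℝ) k, ∑ j, (∑ l, A k l * h j l) ^ 2 = P k * Z k h := by
    intro h k
    simp only [hZ, Finset.mul_sum]
    refine Finset.sum_congr rfl fun j _ => ?_
    have : ∑ l, A k l * h j l = √(P k) * ∑ l, B k l * h j l := by
      rw [Finset.mul_sum]
      exact Finset.sum_congr rfl fun l _ => by rw [hB2 k l]; ring
    rw [this, mul_pow, Real.sq_sqrt (hP0 k)]
  have hE := fun k => (integral_exp_mul_sum_sq_linearComb (J := J) (B k) (hB1 k)
    (s := 1 / 4) (by norm_num))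
  set S : (J → κ → ℝ) → ℝ := fun h => ∑ k, ∑ j, (∑ l, A k l * h j l) ^ 2 with hS
  have hjensen : ∀ h, Real.exp (1 / (4 * T) * S h)
      ≤ ∑ k, P k / T * Real.exp (1 / 4 * Z k h) + (1 - ∑ k, P k / T) := by
    intro h
    -- Jensen's inequality with weights `P k / T`; the extra point `none` sits at `0` and takes the
    -- remaining mass, since the weights only sum to at most one. No independence between the `Z k`
    -- is needed.
    have := convexOn_exp.map_sum_le (t := Finset.univ) (w := fun o : Option τ =>
        o.elim (1 - ∑ k, P k / T) fun k => P k / T)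
      (p := fun o => o.elim 0 fun k => 1 / 4 * Z k h)
      (by
        rintro (_ | k) _
        · simp only [Option.elim, ← Finset.sum_div, sub_nonneg]
          exact (div_le_one hT0).2 hT
        · exact div_nonneg (hP0 k) hT0.le)
      (by simp [Fintype.sum_option]) (by simp)
    simp only [Fintype.sum_option, Option.elim, smul_eq_mul, mul_zero, zero_add, Real.exp_zero,
      mul_one] at this
    have h2 : 1 / (4 * T) * S h = ∑ k, P k / T * (1 / 4 * Z k h) := by
      simp only [hS, hAZ, Finset.mul_sum]
      exact Finset.sum_congr rfl fun k _ => by field_simp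
    rw [h2]; linarith
  have hint1 : Integrable (fun h => ∑ k, P k / T * Real.exp (1 / 4 * Z k h) + (1 - ∑ k, P k / T))
      (gaussianMatrix J κ) :=
    (integrable_finsetSum _ fun k _ => (hE k).2.const_mul _).add (integrable_const _)
  have hint : Integrable (fun h => Real.exp (1 / (4 * T) * S h)) (gaussianMatrix J κ) := by
    refine hint1.mono' (Measurable.aestronglyMeasurable (by fun_prop)) (.of_forall fun h => ?_)
    rw [Real.norm_eq_abs, Real.abs_exp]; exact hjensen h
  have hbase : 1 ≤ (√(1 - 2 * (1 / 4)))⁻¹ := by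
    rw [one_le_inv₀ (by norm_num)]
    exact Real.sqrt_le_one.2 (by norm_num)
  have hmgf : mgf S (gaussianMatrix J κ) (1 / (4 * T)) ≤ Real.exp N := by
    calc mgf S (gaussianMatrix J κ) (1 / (4 * T))
        ≤ ∫ h, (∑ k, P k / T * Real.exp (1 / 4 * Z k h) + (1 - ∑ k, P k / T))
            ∂gaussianMatrix J κ := integral_mono hint hint1 hjensen
      _ = ∑ k, P k / T * (√(1 - 2 * (1 / 4)))⁻¹ ^ Fintype.card J + (1 - ∑ k, P k / T) := by
          rw [integral_add (integrable_finsetSum _ fun k _ => (hE k).2.const_mul _)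
            (integrable_const _), integral_finsetSum _ fun k _ => (hE k).2.const_mul _]
          simp_rw [integral_const_mul]
          simp only [integral_const, probReal_univ, one_smul]
          congr 1
          exact Finset.sum_congr rfl fun k _ => by rw [(hE k).1]
      _ ≤ (√(1 - 2 * (1 / 4)))⁻¹ ^ Fintype.card J := by
          have h1 : 1 ≤ (√(1 - 2 * (1 / 4)))⁻¹ ^ Fintype.card J := one_le_pow₀ hbase
          have h2 : ∑ k, P k / T ≤ 1 := by
            rw [← Finset.sum_div]; exact (div_le_one hT0).2 hT
          rw [← Finset.sum_mul]
          nlinarith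
      _ ≤ Real.exp 1 ^ Fintype.card J := by
          gcongr
          rw [← Real.sqrt_inv]
          have := Real.add_one_le_exp 1
          exact Real.sqrt_le_iff.2 ⟨by positivity, by nlinarith⟩
      _ ≤ Real.exp N := by
          rw [← Real.exp_nat_mul]
          apply Real.exp_le_exp.2
          rw [mul_one]; exact_mod_cast hN
  -- The exponent is `-(1/(4T)) * 8TN = -2N`, against a moment generating function of at most `e^N`.
  have hch := measure_ge_le_exp_mul_mgf (μ := gaussianMatrix J κ) (X := S) (8 * T * N)
    (t := 1 / (4 * T)) (by positivity) hint
  have hmono : (gaussianMatrix J κ).real {h | 8 * T * N < S h}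
      ≤ (gaussianMatrix J κ).real {h | 8 * T * N ≤ S h} :=
    measureReal_mono fun h (hh : 8 * T * N < S h) => hh.le
  refine (hmono.trans hch).trans ?_
  calc _
      ≤ Real.exp (-(1 / (4 * T)) * (8 * T * N)) * Real.exp N := by gcongr
    _ = _ := by
        rw [← Real.exp_add]; congr 1; field_simp; ring

end UpperTail

/-! ### Uniform comparison of the energies on two blocks of columns. -/

section Ratio

/-- If a linear map controls every coordinate from below, then its domain has a family of small
total energy through which every other linear map is controlled. -/
theorem exists_preimages_of_coord_bound {d : ℕ} {E : Type*} [NormedAddCommGroup E]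
    [InnerProductSpace ℝ E] [FiniteDimensional ℝ E] (L : (Fin d → ℝ) →ₗ[ℝ] E) {ρ : ℝ} (hρ : 0 < ρ)
    (hL : ∀ (i : Fin d) (a : Fin d → ℝ), a i ^ 2 * ρ ≤ ‖L a‖ ^ 2) :
    ∃ (q : ℕ) (A : Fin q → Fin d → ℝ), ∑ k, ∑ l, A k l ^ 2 ≤ d / ρ ∧
      ∀ a, ∃ c : Fin q → ℝ, a = ∑ k, c k • A k ∧ ∑ k, c k ^ 2 = ‖L a‖ ^ 2 := by
  set f := stdOrthonormalBasis ℝ (LinearMap.range L)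
  choose A hA using fun k => LinearMap.mem_range.1 (f k).2
  have hinj : ∀ a, L a = 0 → a = 0 := by
    intro a ha
    ext i
    have := hL i a
    rw [ha] at this
    simp only [norm_zero, ne_eq, OfNat.ofNat_ne_zero, not_false_eq_true, zero_pow] at this
    have h2 : a i ^ 2 ≤ 0 := by nlinarith [sq_nonneg (a i)]
    simpa using le_antisymm h2 (sq_nonneg _)
  have hLc : ∀ c : Fin _ → ℝ, L (∑ k, c k • A k) = ((∑ k, c k • f k : LinearMap.range L) : E) := by
    intro c
    simp [map_sum, hA]
  have hnorm : ∀ c : Fin (Module.finrank ℝ (LinearMap.range L)) → ℝ,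
      ‖L (∑ k, c k • A k)‖ ^ 2 = ∑ k, c k ^ 2 := by
    intro c
    rw [hLc, ← Submodule.coe_norm, ← f.sum_sq_inner_right]
    simp [inner_sum, inner_smul_right, orthonormal_iff_ite.1 f.orthonormal]
  refine ⟨_, A, ?_, fun a => ?_⟩
  · rw [Finset.sum_comm]
    have : ∀ l, ∑ k, A k l ^ 2 ≤ 1 / ρ := by
      intro l
      -- For this vector both the `l`-th coordinate and the squared norm of the image equal `Q = ∑
      -- k, A k l ^ 2`, so the hypothesis reads `Q² ρ ≤ Q`. In effect this bounds a diagonal entry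
      -- of the inverse Gram matrix.
      have h := hL l (∑ k, A k l • A k)
      rw [hnorm] at h
      have h2 : (∑ k, A k l • A k) l = ∑ k, A k l ^ 2 := by
        simp [Finset.sum_apply, sq]
      rw [h2] at h
      set Q := ∑ k, A k l ^ 2
      have hQ : 0 ≤ Q := by positivity
      rw [le_div_iff₀ hρ]
      rcases hQ.eq_or_lt with h0 | h0
      · rw [← h0]; simp
      · exact le_of_mul_le_mul_left (by nlinarith) h0
    calc _ ≤ ∑ l : Fin d, 1 / ρ := Finset.sum_le_sum fun l _ => this l
      _ = d / ρ := by simp [div_eq_mul_inv]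
  · refine ⟨fun k => ⟪f k, ⟨L a, LinearMap.mem_range_self L a⟩⟫, ?_, ?_⟩
    · rw [← sub_eq_zero]
      apply hinj
      rw [map_sub, hLc, f.sum_repr']
      simp
    · rw [f.sum_sq_inner_right]; rfl

theorem sum_sq_linearComb_le {d q : ℕ} {J : Type*} [Fintype J] (A : Fin q → Fin d → ℝ)
    (h : J → Fin d → ℝ) (c : Fin q → ℝ) :
    ∑ j, (∑ l, (∑ k, c k • A k) l * h j l) ^ 2
      ≤ (∑ k, c k ^ 2) * ∑ k, ∑ j, (∑ l, A k l * h j l) ^ 2 := by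
  rw [Finset.sum_comm (s := (Finset.univ : Finset (Fin q))), Finset.mul_sum]
  refine Finset.sum_le_sum fun j _ => ?_
  have : ∑ l, (∑ k, c k • A k) l * h j l = ∑ k, c k * ∑ l, A k l * h j l := by
    simp only [Finset.sum_apply, Pi.smul_apply, smul_eq_mul, Finset.sum_mul, Finset.mul_sum]
    rw [Finset.sum_comm]
    exact Finset.sum_congr rfl fun k _ => Finset.sum_congr rfl fun l _ => by ring
  rw [this]
  exact Finset.sum_mul_sq_le_sq_mul_sq _ _ _

/-- With high probability, every linear combination of the rows of a Gaussian matrix has its energy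
on the coordinates outside `p` controlled by that on the coordinates in `p`. -/
theorem gaussianMatrix_energy_ratio {m n : ℕ} (hm : 1 ≤ m) (p : Fin n → Prop) [DecidablePred p]
    (hp : 2 * m < Fintype.card {i // p i}) :
    (gaussianMatrix (Fin m) (Fin n)).real
      {g | ∀ a : Fin m → ℝ, ∑ j : {i // ¬ p i}, (∑ k, a k * g k j) ^ 2
        ≤ 4 / smallBallConst * n * ∑ j : {i // p i}, (∑ k, a k * g k j) ^ 2}ᶜ
      ≤ Real.exp (-(m : ℝ)) := by
  obtain ⟨d, rfl⟩ : ∃ d, m = d + 1 := ⟨m - 1, by omega⟩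
  set r := Fintype.card {i // p i} with hr
  have ht := smallBallConst_pos
  have hrn : r ≤ n := by simpa using Fintype.card_subtype_le p
  set B : Set (Fin (d + 1) → Fin n → ℝ) :=
    {g | ∀ a : Fin (d + 1) → ℝ, ∑ j : {i // ¬ p i}, (∑ k, a k * g k j) ^ 2
        ≤ 4 / smallBallConst * n * ∑ j : {i // p i}, (∑ k, a k * g k j) ^ 2} with hB
  have hBc : IsClosed B := by
    simp only [hB, Set.ofPred_forall]
    exact isClosed_iInter fun a => isClosed_le (by fun_prop) (by fun_prop)
  have hBo : MeasurableSet Bᶜ := hBc.measurableSet.compl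
  set Bad : Set ({i // p i} → Fin (d + 1) → ℝ) := ⋃ i : Fin (d + 1), {G | ∃ a : Fin (d + 1) → ℝ,
    a i = 1 ∧ ∑ j, (∑ k, a k * G j k) ^ 2 < smallBallConst * r} with hBad
  have hBad_o : IsOpen Bad := by
    have : Bad = ⋃ i : Fin (d + 1), ⋃ a : {a : Fin (d + 1) → ℝ // a i = 1},
        {G | ∑ j, (∑ k, a.1 k * G j k) ^ 2 < smallBallConst * r} := by
      ext g; simp [hBad]
    rw [this]
    exact isOpen_iUnion fun i => isOpen_iUnion fun a => isOpen_lt (by fun_prop) (by fun_prop)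
  have hBad_le : (gaussianMatrix {i // p i} (Fin (d + 1))) Bad
      ≤ ENNReal.ofReal ((d + 1) * Real.exp (-2 * r)) := by
    rw [← ofReal_measureReal]
    refine ENNReal.ofReal_le_ofReal ?_
    rw [measureReal_def, ← (measurePreserving_swap_gaussianMatrix (Fin (d + 1))
      {i // p i}).measure_preimage hBad_o.measurableSet.nullMeasurableSet, ← measureReal_def, hBad,
      Set.preimage_iUnion]
    refine (measureReal_iUnion_fintype_le _).trans ?_
    calc _ ≤ ∑ i : Fin (d + 1), Real.exp (-2 * r) :=
          Finset.sum_le_sum fun i _ => gaussian_row_close_to_span_le (by omega) i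
      _ = _ := by simp
  set μc : Fin n → Measure (Fin (d + 1) → ℝ) := fun _ => Measure.pi fun _ => gaussianReal 0 1
  have hmp : MeasurePreserving (fun q : ({i // p i} → Fin (d + 1) → ℝ) ×
      ({i // ¬ p i} → Fin (d + 1) → ℝ) => fun (k : Fin (d + 1)) (i : Fin n) =>
        (MeasurableEquiv.piEquivPiSubtypeProd (fun _ : Fin n => Fin (d + 1) → ℝ) p).symm q i k)
      ((gaussianMatrix {i // p i} (Fin (d + 1))).prod (gaussianMatrix {i // ¬ p i} (Fin (d + 1))))
      (gaussianMatrix (Fin (d + 1)) (Fin n)) :=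
    (measurePreserving_swap_gaussianMatrix (Fin n) (Fin (d + 1))).comp
      (measurePreserving_piEquivPiSubtypeProd μc p).symm
  -- With the columns in `p` frozen at a good `G`, the family `A` built from them is deterministic
  -- and the other columns are still Gaussian.
  have hslice : ∀ G ∉ Bad, (gaussianMatrix {i // ¬ p i} (Fin (d + 1))) {H |
      ¬ ∀ a : Fin (d + 1) → ℝ, ∑ j : {i // ¬ p i}, (∑ k, a k * H j k) ^ 2
        ≤ 4 / smallBallConst * n * ∑ j : {i // p i}, (∑ k, a k * G j k) ^ 2}
      ≤ ENNReal.ofReal (Real.exp (-(n : ℝ))) := by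
    intro G hG
    let L : (Fin (d + 1) → ℝ) →ₗ[ℝ] EuclideanSpace ℝ {i // p i} :=
      (WithLp.linearEquiv 2 ℝ ({i // p i} → ℝ)).symm.toLinearMap ∘ₗ
        (Matrix.mulVecLin (Matrix.of G))
    have hLn : ∀ a, ‖L a‖ ^ 2 = ∑ j, (∑ k, a k * G j k) ^ 2 := by
      intro a
      rw [EuclideanSpace.real_norm_sq_eq]
      refine Finset.sum_congr rfl fun j _ => ?_
      simp [L, Matrix.mulVec, dotProduct, mul_comm]
    obtain ⟨q, A, hA1, hA2⟩ := exists_preimages_of_coord_bound L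
      (ρ := smallBallConst * r) (mul_pos ht (by exact_mod_cast (by omega))) (by
        intro i a
        by_contra hlt
        push Not at hlt
        rw [hLn] at hlt
        have hai : a i ≠ 0 := by
          rintro h
          rw [h] at hlt
          have : 0 ≤ ∑ j, (∑ k, a k * G j k) ^ 2 := by positivity
          simp at hlt; linarith
        -- Normalising `a` to have `i`-th coordinate one turns a violation of the bound into
        -- membership in `Bad`.
        refine hG (Set.mem_iUnion.2 ⟨i, (a i)⁻¹ • a, by simp [hai], ?_⟩)
        have : ∑ j, (∑ k, ((a i)⁻¹ • a) k * G j k) ^ 2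
            = (a i ^ 2)⁻¹ * ∑ j, (∑ k, a k * G j k) ^ 2 := by
          rw [Finset.mul_sum]
          refine Finset.sum_congr rfl fun j _ => ?_
          simp only [Pi.smul_apply, smul_eq_mul, mul_assoc, ← Finset.mul_sum]
          rw [mul_pow, inv_pow]
        rw [this, inv_mul_lt_iff₀ (by positivity)]
        exact hlt)
    -- From `2(d + 1) ≤ r`, the total `(d + 1)/(smallBallConst * r)` is at most `T = 1/(2 *
    -- smallBallConst)`; then `8 * T * n` is the constant of the statement.
    have hT : ∑ k, ∑ l, A k l ^ 2 ≤ 1 / (2 * smallBallConst) := by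
      refine hA1.trans ?_
      have hr0 : (0 : ℝ) < r := by exact_mod_cast (by omega)
      rw [div_le_div_iff₀ (by positivity) (by positivity)]
      have : (2 * (d + 1 : ℕ) : ℝ) ≤ r := by exact_mod_cast (by omega)
      nlinarith
    have htail := gaussianMatrix_sum_sq_mul_le (J := {i // ¬ p i}) A hT (by positivity) (N := n)
      ((Fintype.card_subtype_le fun i => ¬ p i).trans (Fintype.card_fin n).le)
    rw [← ofReal_measureReal]
    refine ENNReal.ofReal_le_ofReal (le_trans (measureReal_mono ?_) htail)
    intro H hH
    by_contra hle
    simp only [Set.mem_ofPred_eq, not_lt] at hle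
    refine hH fun a => ?_
    obtain ⟨c, hc1, hc2⟩ := hA2 a
    rw [← hLn, ← hc2]
    conv_lhs => rw [hc1]
    refine (sum_sq_linearComb_le A H c).trans ?_
    rw [mul_comm]
    gcongr
    refine hle.trans (le_of_eq ?_)
    field_simp; ring
  rw [measureReal_def, ← hmp.measure_preimage hBo.nullMeasurableSet,
    Measure.prod_apply (hmp.measurable hBo)]
  refine ENNReal.toReal_le_of_le_ofReal (Real.exp_pos _).le ?_
  calc _ ≤ ∫⁻ G, (Bad.indicator 1 G + ENNReal.ofReal (Real.exp (-(n : ℝ))))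
          ∂gaussianMatrix {i // p i} (Fin (d + 1)) := by
        refine lintegral_mono fun G => ?_
        by_cases hG : G ∈ Bad
        · rw [Set.indicator_of_mem hG]
          exact prob_le_one.trans le_self_add
        · refine le_trans (le_trans (measure_mono ?_) (hslice G hG)) le_add_self
          intro H hH hall
          refine hH fun a => ?_
          have e1 : ∀ (j : {i // ¬ p i}), (MeasurableEquiv.piEquivPiSubtypeProd
              (fun _ : Fin n => Fin (d + 1) → ℝ) p).symm (G, H) j = H j := fun j => by
            simp [MeasurableEquiv.piEquivPiSubtypeProd, Equiv.piEquivPiSubtypeProd, j.2]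
          have e2 : ∀ (j : {i // p i}), (MeasurableEquiv.piEquivPiSubtypeProd
              (fun _ : Fin n => Fin (d + 1) → ℝ) p).symm (G, H) j = G j := fun j => by
            simp [MeasurableEquiv.piEquivPiSubtypeProd, Equiv.piEquivPiSubtypeProd, j.2]
          simp only [e1, e2]
          exact hall a
    _ = (gaussianMatrix {i // p i} (Fin (d + 1))) Bad + ENNReal.ofReal (Real.exp (-(n : ℝ))) := by
        rw [lintegral_add_right _ measurable_const, lintegral_indicator_one hBad_o.measurableSet]
        simp
    _ ≤ ENNReal.ofReal ((d + 1) * Real.exp (-2 * r)) + ENNReal.ofReal (Real.exp (-(n : ℝ))) := by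
        gcongr
    _ = ENNReal.ofReal ((d + 1) * Real.exp (-2 * r) + Real.exp (-(n : ℝ))) :=
        (ENNReal.ofReal_add (by positivity) (by positivity)).symm
    _ ≤ _ := by
        refine ENNReal.ofReal_le_ofReal ?_
        set M : ℝ := ((d + 1 : ℕ) : ℝ) with hM
        have hM1 : 1 ≤ M := by rw [hM]; push_cast; linarith [d.cast_nonneg (α := ℝ)]
        have hMr : 2 * M + 1 ≤ r := by rw [hM]; exact_mod_cast (by omega)
        have hrn' : (r : ℝ) ≤ n := by exact_mod_cast hrn
        have e1 : ((d : ℝ) + 1) ≤ Real.exp M := by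
          have := Real.add_one_le_exp M
          push_cast at hM; linarith
        have e2 : Real.exp (-1) ≤ 1 / 2 := by
          rw [Real.exp_neg, one_div]
          have := Real.add_one_le_exp 1
          gcongr; linarith
        -- As `2M + 1 ≤ r ≤ n`, both terms are at most `e^(-M-1)`, and `2/e ≤ 1`.
        calc ((d : ℝ) + 1) * Real.exp (-2 * r) + Real.exp (-(n : ℝ))
            ≤ Real.exp M * Real.exp (-2 * r) + Real.exp (-(n : ℝ)) := by gcongr
          _ = Real.exp (M - 2 * r) + Real.exp (-(n : ℝ)) := by
              rw [← Real.exp_add]; congr 2; ring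
          _ ≤ Real.exp (-M + -1) + Real.exp (-M + -1) :=
              add_le_add (Real.exp_le_exp.2 (by linarith)) (Real.exp_le_exp.2 (by linarith))
          _ = Real.exp (-M) * (2 * Real.exp (-1)) := by rw [Real.exp_add]; ring
          _ ≤ Real.exp (-M) * 1 := by gcongr; linarith
          _ = _ := mul_one _

end Ratio

/-! ### Invariance under column permutations and sign changes. -/

section SymmetriesOfGaussianMatrix

theorem measurePreserving_permute_gaussianMatrix {κ ι : Type*} [Fintype κ] [Fintype ι]
    (e : Equiv.Perm ι) :
    MeasurePreserving (fun (g : κ → ι → ℝ) k i => g k (e i))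
      (gaussianMatrix κ ι) (gaussianMatrix κ ι) := by
  refine measurePreserving_pi (fun _ : κ => Measure.pi fun _ : ι => gaussianReal 0 1)
    (fun _ : κ => Measure.pi fun _ : ι => gaussianReal 0 1) (f := fun _ (x : ι → ℝ) i => x (e i))
    (fun _ => ⟨by fun_prop, (Measure.pi_eq fun s hs => ?_).symm⟩)
  rw [Measure.map_apply (by fun_prop) (MeasurableSet.univ_pi hs)]
  have : (fun (f : ι → ℝ) i => f (e i)) ⁻¹' Set.univ.pi s
      = Set.univ.pi fun i => s (e.symm i) := by
    ext f
    simp only [Set.mem_preimage, Set.mem_univ_pi]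
    exact ⟨fun h i => by simpa using h (e.symm i), fun h i => by simpa using h (e i)⟩
  rw [this, Measure.pi_pi]
  exact Equiv.prod_comp e.symm fun i => gaussianReal 0 1 (s i)

theorem measurePreserving_neg_column_gaussianMatrix {κ ι : Type*} [Fintype κ] [Fintype ι]
    [DecidableEq ι] (j : ι) :
    MeasurePreserving (fun (g : κ → ι → ℝ) k i => if i = j then -g k i else g k i)
      (gaussianMatrix κ ι) (gaussianMatrix κ ι) := by
  refine measurePreserving_pi (fun _ : κ => Measure.pi fun _ : ι => gaussianReal 0 1)
    (fun _ : κ => Measure.pi fun _ : ι => gaussianReal 0 1)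
    (f := fun _ (x : ι → ℝ) i => if i = j then -x i else x i) (fun _ => ?_)
  refine measurePreserving_pi (fun _ : ι => gaussianReal 0 1) (fun _ : ι => gaussianReal 0 1)
    (f := fun i (x : ℝ) => if i = j then -x else x) fun i => ?_
  by_cases h : i = j
  · simp only [h, if_true]
    exact ⟨by fun_prop, by rw [gaussianReal_map_neg]; simp⟩
  · simp only [h, if_false]
    exact .id _

end SymmetriesOfGaussianMatrix

/-! ### Expected projection of a fixed vector onto the span of the samples. -/

section RandomSubspace

variable {m n : ℕ} {E : Type*} [NormedAddCommGroup E] [InnerProductSpace ℝ E] (b : OrthonormalBasis (Fin n) ℝ E) (σ : Fin n → ℝ)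

/-- The vector with coordinates `σ i * x i` in the orthonormal basis `b`. -/
noncomputable def scaledVector (x : Fin n → ℝ) : E := ∑ i, (σ i * x i) • b i

/-- The linear combination with coefficients `a` of the scaled rows of `g`. -/
noncomputable def scaledComb (g : Fin m → Fin n → ℝ) (a : Fin m → ℝ) : E :=
  scaledVector b σ fun i => ∑ k, a k * g k i

/-- The span of the scaled rows of `g`. -/
noncomputable def scaledSpan (g : Fin m → Fin n → ℝ) : Submodule ℝ E :=
  Submodule.span ℝ (Set.range fun k => scaledVector b σ (g k))

theorem scaledComb_eq_sum (g : Fin m → Fin n → ℝ) (a : Fin m → ℝ) :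
    scaledComb b σ g a = ∑ k, a k • scaledVector b σ (g k) := by
  simp only [scaledComb, scaledVector, Finset.mul_sum, Finset.sum_smul, Finset.smul_sum, smul_smul]
  rw [Finset.sum_comm]
  exact Finset.sum_congr rfl fun k _ => Finset.sum_congr rfl fun i _ => by congr 1; ring

theorem mem_scaledSpan (g : Fin m → Fin n → ℝ) (x : E) :
    x ∈ scaledSpan b σ g ↔ ∃ a, scaledComb b σ g a = x := by
  simp_rw [scaledComb_eq_sum, scaledSpan]
  exact Submodule.mem_span_range_iff_exists_fun ℝ

theorem inner_scaledComb (g : Fin m → Fin n → ℝ) (a : Fin m → ℝ) (i : Fin n) :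
    ⟪b i, scaledComb b σ g a⟫ = σ i * ∑ k, a k * g k i := by
  simp [scaledComb, scaledVector, inner_sum, inner_smul_right,
    orthonormal_iff_ite.1 b.orthonormal]

theorem norm_sub_scaledComb_sq (u : E) (g : Fin m → Fin n → ℝ) (a : Fin m → ℝ) :
    ‖u - scaledComb b σ g a‖ ^ 2 = ∑ i, (⟪b i, u⟫ - σ i * ∑ k, a k * g k i) ^ 2 := by
  rw [← b.sum_sq_inner_right]
  simp_rw [inner_sub_right, inner_scaledComb]

variable [FiniteDimensional ℝ E]

/-- The energy of the orthogonal projection of `u` to the span of the scaled rows. -/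
noncomputable def projEnergy (u : E) (g : Fin m → Fin n → ℝ) : ℝ :=
  ‖(scaledSpan b σ g).starProjection u‖ ^ 2

theorem norm_sub_starProjection_sq (u : E) (g : Fin m → Fin n → ℝ) :
    ‖u - (scaledSpan b σ g).starProjection u‖ ^ 2 = ‖u‖ ^ 2 - projEnergy b σ u g := by
  have h := Submodule.norm_sq_eq_add_norm_sq_starProjection u (scaledSpan b σ g)
  rw [projEnergy, h, Submodule.starProjection_orthogonal']
  simp

theorem norm_sq_sub_projEnergy_le (u : E) (g : Fin m → Fin n → ℝ) (a : Fin m → ℝ) :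
    ‖u‖ ^ 2 - projEnergy b σ u g ≤ ‖u - scaledComb b σ g a‖ ^ 2 := by
  rw [← norm_sub_starProjection_sq]
  gcongr
  rw [Submodule.starProjection_minimal]
  exact ciInf_le ⟨0, by rintro _ ⟨x, rfl⟩; positivity⟩
    (⟨_, (mem_scaledSpan b σ g _).2 ⟨a, rfl⟩⟩ : scaledSpan b σ g)

theorem exists_norm_sub_scaledComb_eq (u : E) (g : Fin m → Fin n → ℝ) :
    ∃ a, ‖u - scaledComb b σ g a‖ ^ 2 = ‖u‖ ^ 2 - projEnergy b σ u g := by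
  obtain ⟨a, ha⟩ := (mem_scaledSpan b σ g _).1
    (Submodule.starProjection_apply_mem (scaledSpan b σ g) u)
  exact ⟨a, by rw [ha, norm_sub_starProjection_sq]⟩

/-- For vectors of equal norm, a larger projection means a better best approximation, so projections
can be compared by transforming coefficients. -/
theorem projEnergy_le_of_forall_exists {u u' : E} (huu : ‖u‖ = ‖u'‖) {σ' : Fin n → ℝ}
    {g g' : Fin m → Fin n → ℝ}
    (h : ∀ a, ∃ a', ‖u' - scaledComb b σ' g' a'‖ ^ 2 ≤ ‖u - scaledComb b σ g a‖ ^ 2) :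
    projEnergy b σ u g ≤ projEnergy b σ' u' g' := by
  obtain ⟨a, ha⟩ := exists_norm_sub_scaledComb_eq b σ u g
  obtain ⟨a', ha'⟩ := h a
  have := norm_sq_sub_projEnergy_le b σ' u' g' a'
  rw [huu] at ha
  linarith

theorem projEnergy_nonneg (u : E) (g : Fin m → Fin n → ℝ) : 0 ≤ projEnergy b σ u g := by
  unfold projEnergy; positivity

theorem projEnergy_le (u : E) (g : Fin m → Fin n → ℝ) : projEnergy b σ u g ≤ ‖u‖ ^ 2 := by
  unfold projEnergy
  gcongr
  exact Submodule.norm_starProjection_apply_le _ _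

/-- The projection exceeds a level exactly when some coefficient vector approximates `u` well
enough. Each superlevel set is thus a union of open sets, although the span itself may vary
discontinuously. -/
theorem measurable_projEnergy (u : E) : Measurable (projEnergy (m := m) b σ u) := by
  refine measurable_of_Ioi fun c => ?_
  have : projEnergy (m := m) b σ u ⁻¹' Set.Ioi c
      = ⋃ a : Fin m → ℝ, {g | ∑ i, (⟪b i, u⟫ - σ i * ∑ k, a k * g k i) ^ 2 < ‖u‖ ^ 2 - c} := by
    ext g
    simp only [Set.mem_preimage, Set.mem_Ioi, Set.mem_iUnion, Set.mem_ofPred_eq,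
      ← norm_sub_scaledComb_sq]
    constructor
    · intro h
      obtain ⟨a, ha⟩ := exists_norm_sub_scaledComb_eq b σ u g
      exact ⟨a, by linarith⟩
    · rintro ⟨a, ha⟩
      have := norm_sq_sub_projEnergy_le b σ u g a
      linarith
  rw [this]
  exact (isOpen_iUnion fun a => isOpen_lt (by fun_prop) (by fun_prop)).measurableSet

theorem integrable_projEnergy (u : E) :
    Integrable (projEnergy b σ u) (gaussianMatrix (Fin m) (Fin n)) :=
  Integrable.of_bound (measurable_projEnergy b σ u).aestronglyMeasurable (‖u‖ ^ 2)
    (.of_forall fun g => by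
      rw [Real.norm_of_nonneg (projEnergy_nonneg b σ u g)]; exact projEnergy_le b σ u g)

/-- The sum is the trace of an orthogonal projection of rank at most `m`. -/
theorem sum_projEnergy_le (g : Fin m → Fin n → ℝ) : ∑ i, projEnergy b σ (b i) g ≤ m := by
  set S := scaledSpan b σ g
  set f := stdOrthonormalBasis ℝ S
  have h1 : ∀ i, projEnergy b σ (b i) g = ∑ k, ⟪(f k : E), b i⟫ ^ 2 := by
    intro i
    have : projEnergy b σ (b i) g = ‖S.orthogonalProjectionOnto (b i)‖ ^ 2 := rfl
    rw [this, ← f.sum_sq_inner_right]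
    refine Finset.sum_congr rfl fun k _ => ?_
    rw [Submodule.inner_orthogonalProjectionOnto_eq_of_mem_left]
  simp_rw [h1]
  rw [Finset.sum_comm]
  have h2 : ∀ k, ∑ i, ⟪(f k : E), b i⟫ ^ 2 = 1 := by
    intro k
    rw [b.sum_sq_inner_left, ← Submodule.coe_norm, f.norm_eq_one, one_pow]
  simp_rw [h2]
  have : Module.finrank ℝ S ≤ m := (finrank_range_le_card (R := ℝ)
    (fun k => scaledVector b σ (g k))).trans (by simp)
  simpa using this

/-- Swapping columns `i` and `j` preserves the law. After the swap, an approximation of `b j` with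
coefficients `a` becomes one of `b i` with coefficients `(σ j / σ i) • a`: the error along the
target is unchanged, and every other error shrinks because `σ j ≤ σ i`. -/
theorem integral_projEnergy_anti {i j : Fin n} (hj : 0 < σ j) (hij : σ j ≤ σ i) :
    ∫ g, projEnergy b σ (b j) g ∂gaussianMatrix (Fin m) (Fin n)
      ≤ ∫ g, projEnergy b σ (b i) g ∂gaussianMatrix (Fin m) (Fin n) := by
  rcases eq_or_ne i j with rfl | hne
  · exact le_rfl
  have hmp := measurePreserving_permute_gaussianMatrix (κ := Fin m) (Equiv.swap i j)
  have hi : 0 < σ i := hj.trans_le hij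
  have hint := integrable_projEnergy (m := m) b σ (b j)
  rw [← hmp.map_eq] at hint
  have hT : ∫ g, projEnergy b σ (b j) g ∂gaussianMatrix (Fin m) (Fin n)
      = ∫ g, projEnergy b σ (b j) (fun k l => g k (Equiv.swap i j l))
        ∂gaussianMatrix (Fin m) (Fin n) := by
    conv_lhs => rw [← hmp.map_eq, integral_map hmp.measurable.aemeasurable
      (measurable_projEnergy b σ _).aestronglyMeasurable]
  rw [hT]
  refine integral_mono (hint.comp_measurable hmp.measurable)
    (integrable_projEnergy b σ (b i)) fun g => ?_
  refine projEnergy_le_of_forall_exists b σ (by simp) fun a => ⟨(σ j / σ i) • a, ?_⟩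
  rw [norm_sub_scaledComb_sq, norm_sub_scaledComb_sq, ← Equiv.sum_comp (Equiv.swap i j)
    fun l => (⟪b l, b j⟫ - σ l * ∑ k, a k * g k (Equiv.swap i j l)) ^ 2]
  refine Finset.sum_le_sum fun l _ => ?_
  simp only [Equiv.swap_apply_self, orthonormal_iff_ite.1 b.orthonormal, Pi.smul_apply,
    smul_eq_mul, mul_assoc, ← Finset.mul_sum]
  set y := ∑ k, a k * g k l
  have hθ : σ j / σ i ≤ 1 := (div_le_one hi).2 hij
  have hθ0 : 0 < σ j / σ i := by positivity
  rcases eq_or_ne l i with rfl | hli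
  · rw [Equiv.swap_apply_left, if_pos rfl, if_pos rfl, ← mul_assoc, mul_div_cancel₀ _ hi.ne']
  rcases eq_or_ne l j with rfl | hlj
  · rw [Equiv.swap_apply_right, if_neg hli, if_neg hne]
    have h1 : σ l * (σ l / σ i) ≤ σ i := by nlinarith
    have h2 : (σ l * (σ l / σ i)) ^ 2 ≤ σ i ^ 2 := by gcongr
    nlinarith [mul_le_mul_of_nonneg_right h2 (sq_nonneg y)]
  · rw [Equiv.swap_apply_of_ne_of_ne hli hlj, if_neg hli, if_neg hlj]
    have h2 : (σ j / σ i) ^ 2 ≤ 1 ^ 2 := by gcongr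
    nlinarith [mul_le_mul_of_nonneg_right h2 (sq_nonneg (σ l * y))]

/-- Negating column `j` preserves the law and reflects `b j`. By polarization, the off-diagonal
entries of the expected projection vanish. -/
theorem integral_projEnergy_add_eq_sub {i j : Fin n} (hij : i ≠ j) :
    ∫ g, projEnergy b σ (b i + b j) g ∂gaussianMatrix (Fin m) (Fin n)
      = ∫ g, projEnergy b σ (b i - b j) g ∂gaussianMatrix (Fin m) (Fin n) := by
  have hmp := measurePreserving_neg_column_gaussianMatrix (κ := Fin m) j
  conv_lhs => rw [← hmp.map_eq, integral_map hmp.measurable.aemeasurable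
      (measurable_projEnergy b σ _).aestronglyMeasurable]
  congr 1
  ext g
  have hinner : ⟪b i, b j⟫ = 0 := b.inner_eq_zero hij
  have hnorm : ‖b i + b j‖ = ‖b i - b j‖ := by
    rw [← sq_eq_sq₀ (norm_nonneg _) (norm_nonneg _), norm_add_sq_real, norm_sub_sq_real, hinner]
    ring
  have key : ∀ a, ‖b i + b j - scaledComb b σ (fun k l => if l = j then -g k l else g k l) a‖ ^ 2
      = ‖b i - b j - scaledComb b σ g a‖ ^ 2 := by
    intro a
    rw [norm_sub_scaledComb_sq, norm_sub_scaledComb_sq]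
    refine Finset.sum_congr rfl fun l _ => ?_
    simp only [inner_add_right, inner_sub_right, orthonormal_iff_ite.1 b.orthonormal]
    rcases eq_or_ne l j with rfl | hl
    · simp [hij.symm]; ring
    · simp [hl]
  exact le_antisymm
    (projEnergy_le_of_forall_exists b σ hnorm fun a => ⟨a, (key a).ge⟩)
    (projEnergy_le_of_forall_exists b σ hnorm.symm fun a => ⟨a, (key a).le⟩)

theorem integral_projEnergy_eq_sum (u : E) :
    ∫ g, projEnergy b σ u g ∂gaussianMatrix (Fin m) (Fin n)
      = ∑ i, ⟪b i, u⟫ ^ 2 * ∫ g, projEnergy b σ (b i) g ∂gaussianMatrix (Fin m) (Fin n) := by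
  have h1 : ∀ g : Fin m → Fin n → ℝ, projEnergy b σ u g = ∑ i, ∑ j, ⟪b i, u⟫ * ⟪b j, u⟫ *
      ((projEnergy b σ (b i + b j) g - projEnergy b σ (b i - b j) g) / 4) := by
    intro g
    have h2 : ∀ i j, (projEnergy b σ (b i + b j) g - projEnergy b σ (b i - b j) g) / 4
        = ⟪(scaledSpan b σ g).starProjection (b i), (scaledSpan b σ g).starProjection (b j)⟫ := by
      intro i j
      rw [projEnergy, projEnergy, map_add, map_sub, norm_add_sq_real, norm_sub_sq_real]
      ring
    simp_rw [h2]
    conv_lhs => rw [projEnergy, ← b.sum_repr' u, map_sum, ← real_inner_self_eq_norm_sq]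
    simp_rw [map_smul, sum_inner, inner_sum, inner_smul_left, inner_smul_right]
    simp [mul_assoc]
  simp_rw [h1]
  have hint : ∀ i j, Integrable (fun g => ⟪b i, u⟫ * ⟪b j, u⟫ *
      ((projEnergy b σ (b i + b j) g - projEnergy b σ (b i - b j) g) / 4))
      (gaussianMatrix (Fin m) (Fin n)) := fun i j =>
    (((integrable_projEnergy b σ _).sub (integrable_projEnergy b σ _)).div_const 4).const_mul _
  rw [integral_finsetSum _ fun i _ => integrable_finsetSum _ fun j _ => hint i j]
  refine Finset.sum_congr rfl fun i _ => ?_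
  rw [integral_finsetSum _ fun j _ => hint i j, Finset.sum_eq_single i]
  · rw [integral_const_mul, ← sq]
    congr 2
    ext g
    have h2 : b i + b i = (2 : ℝ) • b i := (two_smul ℝ _).symm
    simp only [projEnergy, h2, sub_self, map_smul, map_zero, norm_smul, norm_zero]
    norm_num; ring
  · intro j _ hji
    rw [integral_const_mul, integral_div, integral_sub (integrable_projEnergy b σ _)
      (integrable_projEnergy b σ _), integral_projEnergy_add_eq_sub b σ hji.symm]
    simp
  · simp

/-- The expected energy of the projection to the span of the samples, when the variance is maximal
on the coordinates in `I`. -/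
theorem integral_projEnergy_le (hσ : ∀ i, 0 < σ i) (I : Finset (Fin n)) (hI : I.Nonempty)
    (hmax : ∀ i ∈ I, ∀ j, σ j ≤ σ i) (u : E) :
    ∫ g, projEnergy b σ u g ∂gaussianMatrix (Fin m) (Fin n) ≤ m / I.card * ‖u‖ ^ 2 := by
  have hc : (0 : ℝ) < I.card := by exact_mod_cast hI.card_pos
  have hle : ∀ j, ∫ g, projEnergy b σ (b j) g ∂gaussianMatrix (Fin m) (Fin n) ≤ m / I.card := by
    intro j
    rw [le_div_iff₀ hc, mul_comm, ← nsmul_eq_mul]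
    calc I.card • ∫ g, projEnergy b σ (b j) g ∂gaussianMatrix (Fin m) (Fin n)
        ≤ ∑ i ∈ I, ∫ g, projEnergy b σ (b i) g ∂gaussianMatrix (Fin m) (Fin n) :=
          Finset.card_nsmul_le_sum _ _ _ fun i hi =>
            integral_projEnergy_anti b σ (hσ j) (hmax i hi j)
      _ = ∫ g, ∑ i ∈ I, projEnergy b σ (b i) g ∂gaussianMatrix (Fin m) (Fin n) :=
          (integral_finsetSum _ fun i _ => integrable_projEnergy b σ _).symm
      _ ≤ ∫ g, (m : ℝ) ∂gaussianMatrix (Fin m) (Fin n) := by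
          refine integral_mono (integrable_finsetSum _ fun i _ => integrable_projEnergy b σ _)
            (integrable_const _) fun g => ?_
          exact (Finset.sum_le_sum_of_subset_of_nonneg (Finset.subset_univ I)
            fun i _ _ => projEnergy_nonneg b σ (b i) g).trans (sum_projEnergy_le b σ g)
      _ = m := by simp
  rw [integral_projEnergy_eq_sum, ← b.sum_sq_inner_right u, Finset.mul_sum]
  refine Finset.sum_le_sum fun i _ => ?_
  rw [mul_comm]
  gcongr
  exact hle i

/-- A fixed vector is likely to be far from the span of the samples. -/
theorem exists_close_scaledComb_le (hσ : ∀ i, 0 < σ i) (I : Finset (Fin n)) (hI : I.Nonempty)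
    (hmax : ∀ i ∈ I, ∀ j, σ j ≤ σ i) (u : E) :
    (gaussianMatrix (Fin m) (Fin n)).real {g | ∀ a, ‖u‖ / 2 ≤ ‖u - scaledComb b σ g a‖}ᶜ
      ≤ 4 * m / (3 * I.card) := by
  have hc : (0 : ℝ) < I.card := by exact_mod_cast hI.card_pos
  rcases eq_or_ne u 0 with rfl | hu
  · have : {g : Fin m → Fin n → ℝ | ∀ a, ‖(0 : E)‖ / 2 ≤ ‖0 - scaledComb b σ g a‖}ᶜ = ∅ := by
      ext g; simp
    rw [this]; simp; positivity
  have hu' : 0 < ‖u‖ ^ 2 := by positivity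
  -- The level `3/4` is `1 - (1/2)²`: being closer than `‖u‖/2` to the span forces at least this
  -- share of the energy into the projection.
  have hM := mul_meas_ge_le_integral_of_nonneg (μ := gaussianMatrix (Fin m) (Fin n))
    (.of_forall fun g => projEnergy_nonneg b σ u g) (integrable_projEnergy b σ u)
    (3 / 4 * ‖u‖ ^ 2)
  have h2 := hM.trans (integral_projEnergy_le b σ hσ I hI hmax u)
  have h3 : (gaussianMatrix (Fin m) (Fin n)).real {g | 3 / 4 * ‖u‖ ^ 2 ≤ projEnergy b σ u g}
      ≤ 4 * m / (3 * I.card) := by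
    refine le_of_mul_le_mul_left (h2.trans (le_of_eq ?_)) (by positivity : 0 < 3 / 4 * ‖u‖ ^ 2)
    field_simp
  refine le_trans (measureReal_mono ?_) h3
  intro g hg
  simp only [Set.mem_compl_iff, Set.mem_ofPred_eq, not_forall, not_le] at hg ⊢
  obtain ⟨a, ha⟩ := hg
  have h4 := norm_sq_sub_projEnergy_le b σ u g a
  have h5 : ‖u - scaledComb b σ g a‖ ^ 2 ≤ (‖u‖ / 2) ^ 2 := by gcongr
  nlinarith

end RandomSubspace

/-! ### Consequences of quantitative density. -/

section Geometry

variable {n : ℕ}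

/-- Restriction to the coordinates in `U`, as a linear map. -/
noncomputable def coordRestrictLin (U : Finset (Fin n)) :
    EuclideanSpace ℝ (Fin n) →ₗ[ℝ] EuclideanSpace ℝ U where
  toFun := coordRestrict U
  map_add' _ _ := rfl
  map_smul' _ _ := rfl

theorem coordRestrict_sub (U : Finset (Fin n)) (x y : EuclideanSpace ℝ (Fin n)) :
    coordRestrict U (x - y) = coordRestrict U x - coordRestrict U y := rfl

theorem norm_coordRestrict_sq (U : Finset (Fin n)) (x : EuclideanSpace ℝ (Fin n)) :
    ‖coordRestrict U x‖ ^ 2 = ∑ i ∈ U, x i ^ 2 := by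
  rw [EuclideanSpace.real_norm_sq_eq]
  exact Finset.sum_coe_sort U fun i => x i ^ 2

theorem norm_coordRestrict_le (U : Finset (Fin n)) (x : EuclideanSpace ℝ (Fin n)) :
    ‖coordRestrict U x‖ ≤ ‖x‖ := by
  rw [← sq_le_sq₀ (norm_nonneg _) (norm_nonneg _), norm_coordRestrict_sq,
    EuclideanSpace.real_norm_sq_eq]
  exact Finset.sum_le_sum_of_subset_of_nonneg (Finset.subset_univ _) fun _ _ _ => sq_nonneg _

theorem norm_coordRestrict_univ (x : EuclideanSpace ℝ (Fin n)) :
    ‖coordRestrict Finset.univ x‖ = ‖x‖ := by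
  rw [← sq_eq_sq₀ (norm_nonneg _) (norm_nonneg _), norm_coordRestrict_sq,
    EuclideanSpace.real_norm_sq_eq]

theorem exists_supported_compl (U : Finset (Fin n)) (x : EuclideanSpace ℝ (Fin n)) :
    ∃ y, coordRestrict U y = 0 ∧ ‖x - y‖ = ‖coordRestrict U x‖ := by
  classical
  refine ⟨WithLp.toLp 2 fun i => if i ∈ U then 0 else x i, ?_, ?_⟩
  · ext ⟨i, hi⟩
    simp [coordRestrict]
  · rw [← sq_eq_sq₀ (norm_nonneg _) (norm_nonneg _), norm_coordRestrict_sq,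
      EuclideanSpace.real_norm_sq_eq, ← Finset.sum_filter_add_sum_filter_not Finset.univ (· ∈ U)]
    have h2 : ∀ i ∈ Finset.univ.filter (· ∉ U), (x - WithLp.toLp 2
        fun i => if i ∈ U then 0 else x i : EuclideanSpace ℝ (Fin n)) i ^ 2 = 0 := by
      intro i hi
      simp [(Finset.mem_filter.1 hi).2]
    rw [Finset.sum_eq_zero h2, add_zero, Finset.filter_mem_eq_inter, Finset.univ_inter]
    exact Finset.sum_congr rfl fun i hi => by simp [if_pos hi]

variable {V : Submodule ℝ (EuclideanSpace ℝ (Fin n))} {δ η τ : ℝ}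

theorem IsQuantitativelyDense.le_one (h : IsQuantitativelyDense V δ η τ) (hδ : 0 < δ)
    (hτ : 0 < τ) {v : EuclideanSpace ℝ (Fin n)} (hv : v ∈ V) (hv0 : v ≠ 0) : η ≤ 1 := by
  have h1 := h ∅ (by simpa using hτ.le) v (by
    rw [Metric.infDist_zero_of_mem (by exact hv)]; positivity)
  have h2 : 0 < ‖v‖ := norm_pos_iff.2 hv0
  have h3 := h1.trans (norm_coordRestrict_le _ v)
  exact le_of_mul_le_mul_right (by linarith) h2

/-- If `δ ≥ 1`, every vector would be admissible because `0 ∈ V`, including a coordinate vector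
supported in `C`. -/
theorem IsQuantitativelyDense.lt_one (h : IsQuantitativelyDense V δ η τ) (hη : 0 < η)
    {C : Finset (Fin n)} (hC : (C.card : ℝ) ≤ τ) (hne : C.Nonempty) : δ < 1 := by
  obtain ⟨i, hi⟩ := hne
  by_contra hδ
  have h1 := h C hC (EuclideanSpace.single i 1) (by
    refine (Metric.infDist_le_dist_of_mem (x := EuclideanSpace.single i (1 : ℝ))
      (SetLike.mem_coe.2 V.zero_mem)).trans ?_
    simpa using hδ)
  have h2 : ‖coordRestrict Cᶜ (EuclideanSpace.single i (1 : ℝ))‖ = 0 := by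
    rw [← sq_eq_zero_iff, norm_coordRestrict_sq]
    refine Finset.sum_eq_zero fun j hj => ?_
    have : j ≠ i := by rintro rfl; exact (Finset.mem_compl.1 hj) hi
    simp [this]
  rw [h2] at h1
  simp at h1
  linarith

/-- Quantitative density forces a lower bound proportional to `δ`, at the price of halving the
width of the neighbourhood. -/
theorem IsQuantitativelyDense.quarter_le (h : IsQuantitativelyDense V δ η τ) (hδ : 0 < δ)
    (hδ1 : δ < 1) (hη : 0 < η) {P : Finset (Fin n)} (hC : ((Pᶜ).card : ℝ) ≤ τ)
    {x : EuclideanSpace ℝ (Fin n)}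
    (hx : Metric.infDist x (V : Set (EuclideanSpace ℝ (Fin n))) ≤ δ / 2 * ‖x‖) :
    δ / 4 * ‖x‖ ≤ ‖coordRestrict P x‖ := by
  by_contra hlt
  push Not at hlt
  -- Erasing the coordinates in `P` moves `x` by less than `δ/4 * ‖x‖`, so `‖y‖ ≥ 3/4 * ‖x‖` and `y`
  -- is still within `δ * ‖y‖` of `V`. But `y` vanishes on `P`, which density excludes unless `y =
  -- 0`.
  obtain ⟨y, hy, hxy⟩ := exists_supported_compl P x
  have hxy2 : ‖x‖ - ‖y‖ ≤ ‖x - y‖ := norm_sub_norm_le x y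
  have hd : Metric.infDist y (V : Set (EuclideanSpace ℝ (Fin n)))
      ≤ Metric.infDist x (V : Set (EuclideanSpace ℝ (Fin n))) + ‖x - y‖ := by
    have := Metric.infDist_le_infDist_add_dist (s := (V : Set (EuclideanSpace ℝ (Fin n))))
      (x := y) (y := x)
    rwa [dist_comm, dist_eq_norm] at this
  have hx0 := norm_nonneg x
  have hy0 : 3 / 4 * ‖x‖ ≤ ‖y‖ := by nlinarith
  have h1 := h Pᶜ hC y (by nlinarith)
  rw [compl_compl, hy, norm_zero] at h1
  have h2 : ‖y‖ ≤ 0 := by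
    by_contra hy1
    push Not at hy1
    nlinarith [mul_pos hη hy1]
  have h3 : ‖x‖ = 0 := by linarith
  rw [h3] at hlt
  simp only [mul_zero] at hlt
  exact absurd (norm_nonneg _) (not_le.2 hlt)

/-- There is a vector `z`, depending only on `u`, such that every `x` close to `V` and far from `z`
is far from `u` on the coordinates in `P`. -/
theorem IsQuantitativelyDense.exists_test_vector (h : IsQuantitativelyDense V δ η τ) (hδ : 0 < δ)
    (hη : 0 < η) (hτ : 0 < τ) (hV : V ≠ ⊥) {P : Finset (Fin n)} (hP : (n : ℝ) - τ ≤ P.card)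
    (u : EuclideanSpace ℝ (Fin n)) :
    ∃ z : EuclideanSpace ℝ (Fin n), ∀ x : EuclideanSpace ℝ (Fin n), ∀ v ∈ V,
      ‖z‖ / 2 ≤ ‖z - x‖ → ‖x - v‖ ≤ δ / 48 * ‖x‖ →
        η / 32 * ‖coordRestrict P u‖ ≤ ‖coordRestrict P u - coordRestrict P x‖ := by
  obtain ⟨v₀, hv₀, hv₀0⟩ := V.ne_bot_iff.1 hV
  have hη1 := h.le_one hδ hτ hv₀ hv₀0
  have hC : ((Pᶜ).card : ℝ) ≤ τ := by
    rw [Finset.card_compl, Fintype.card_fin, Nat.cast_sub (by simpa using P.card_le_univ)]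
    linarith
  rcases (Pᶜ).eq_empty_or_nonempty with hem | hne
  · have hPu : P = Finset.univ := by simpa using hem
    subst hPu
    refine ⟨u, fun x v _ hx _ => ?_⟩
    rw [← coordRestrict_sub, norm_coordRestrict_univ, norm_coordRestrict_univ]
    nlinarith [norm_nonneg u]
  have hδ1 := h.lt_one hη hC hne
  -- Replacing `η` by `η'` keeps a density estimate and guarantees `δ ≤ 4η'`, so that errors
  -- proportional to `δ` are absorbed by the gain `η'`.
  set η' := max η (δ / 4) with hη'
  have hη'0 : 0 < η' := lt_max_of_lt_left hη
  have hη'1 : η' ≤ 1 := max_le hη1 (by linarith)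
  have hδη : δ ≤ 4 * η' := by linarith [le_max_right η (δ / 4)]
  have hdense : ∀ x, Metric.infDist x (V : Set (EuclideanSpace ℝ (Fin n))) ≤ δ / 2 * ‖x‖ →
      η' * ‖x‖ ≤ ‖coordRestrict P x‖ := by
    intro x hx
    rw [hη', max_mul_of_nonneg _ _ (norm_nonneg x)]
    refine max_le ?_ (h.quarter_le hδ hδ1 hη hC hx)
    have h1 := h Pᶜ hC x (hx.trans (by nlinarith [norm_nonneg x]))
    rwa [compl_compl] at h1
  set W := V.map (coordRestrictLin P)
  -- The test vector is a lift to `V` of the projection of `u_P` onto the restriction of `V`.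
  obtain ⟨s, hs, hsW⟩ := Submodule.mem_map.1
    (Submodule.starProjection_apply_mem W (coordRestrict P u))
  refine ⟨s, fun x v hv hfar hclose => ?_⟩
  have hortho : ∀ y ∈ V, ⟪coordRestrict P u - coordRestrict P s, coordRestrict P y⟫ = 0 := by
    intro y hy
    have h1 : coordRestrict P u - coordRestrict P s ∈ Wᗮ := by
      have : coordRestrict P s = W.starProjection (coordRestrict P u) := hsW
      rw [this]
      exact Submodule.sub_starProjection_mem_orthogonal _
    exact Submodule.inner_left_of_mem_orthogonal (Submodule.mem_map_of_mem hy) h1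
  set q := coordRestrict P u - coordRestrict P s with hq
  have hpyth : ‖q + coordRestrict P (s - v)‖ ^ 2 = ‖q‖ ^ 2 + ‖coordRestrict P (s - v)‖ ^ 2 := by
    rw [norm_add_sq_real, hortho _ (V.sub_mem hs hv)]; ring
  have hq1 : ‖q‖ ≤ ‖q + coordRestrict P (s - v)‖ := by
    rw [← sq_le_sq₀ (norm_nonneg _) (norm_nonneg _)]
    nlinarith [sq_nonneg ‖coordRestrict P (s - v)‖]
  have hq2 : ‖coordRestrict P (s - v)‖ ≤ ‖q + coordRestrict P (s - v)‖ := by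
    rw [← sq_le_sq₀ (norm_nonneg _) (norm_nonneg _)]
    nlinarith [sq_nonneg ‖q‖]
  have hsplit : coordRestrict P u - coordRestrict P x
      = (q + coordRestrict P (s - v)) - coordRestrict P (x - v) := by
    simp only [hq, coordRestrict_sub]; abel
  have hD := norm_sub_norm_le (q + coordRestrict P (s - v)) (coordRestrict P (x - v))
  rw [← hsplit] at hD
  have hw : ‖coordRestrict P (x - v)‖ ≤ ‖x - v‖ := norm_coordRestrict_le _ _
  -- Being far from `s` gives `‖s‖ ≤ 2‖s - x‖`. This turns `δ/48 * ‖x‖` into `δ/16 * ‖s - x‖`.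
  have hxs : ‖x‖ ≤ 3 * ‖s - x‖ := by
    have := norm_sub_norm_le x s
    rw [norm_sub_rev] at this
    linarith
  have hw2 : ‖x - v‖ ≤ δ / 16 * ‖s - x‖ := hclose.trans (by nlinarith)
  have hnear : η' * ‖s - x‖ ≤ ‖coordRestrict P (s - x)‖ := by
    apply hdense
    refine (Metric.infDist_le_dist_of_mem (x := s - x)
      (SetLike.mem_coe.2 (V.sub_mem hs hv))).trans ?_
    rw [dist_eq_norm, show s - x - (s - v) = -(x - v) by abel, norm_neg]
    nlinarith [norm_nonneg (s - x)]
  have hsx : ‖coordRestrict P (s - x)‖ ≤ ‖coordRestrict P (s - v)‖ + ‖coordRestrict P (x - v)‖ := by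
    rw [show s - x = (s - v) - (x - v) by abel, coordRestrict_sub]
    exact norm_sub_le _ _
  have hwη : ‖x - v‖ ≤ η' / 4 * ‖s - x‖ := hw2.trans (by nlinarith [norm_nonneg (s - x)])
  set D := ‖coordRestrict P u - coordRestrict P x‖
  have hD1 : η' / 2 * ‖s - x‖ ≤ D := by linarith
  have hD2 : ‖q‖ ≤ 3 / 2 * D := by linarith
  have hsP : ‖coordRestrict P s‖ ≤ ‖s‖ := norm_coordRestrict_le _ _
  have hu : ‖coordRestrict P u‖ ≤ ‖q‖ + ‖coordRestrict P s‖ := by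
    have := norm_add_le q (coordRestrict P s)
    rwa [hq, sub_add_cancel] at this
  have hD0 : 0 ≤ D := norm_nonneg _
  have hηle : η ≤ η' := le_max_left _ _
  have h1 : η' * ‖coordRestrict P s‖ ≤ η' * (2 * ‖s - x‖) :=
    mul_le_mul_of_nonneg_left (by linarith) hη'0.le
  have h2 : η' * ‖q‖ ≤ 1 * ‖q‖ := mul_le_mul_of_nonneg_right hη'1 (norm_nonneg q)
  have h3 : η' * ‖coordRestrict P u‖ ≤ η' * (‖q‖ + ‖coordRestrict P s‖) :=
    mul_le_mul_of_nonneg_left hu hη'0.le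
  have h4 : η * ‖coordRestrict P u‖ ≤ η' * ‖coordRestrict P u‖ :=
    mul_le_mul_of_nonneg_right hηle (norm_nonneg _)
  -- Altogether `η‖u_P‖ ≤ ‖q‖ + 2η'‖s - x‖ ≤ (3/2 + 4) D`, well within the factor `32`.
  linarith

end Geometry

/-! ### The samples as scaled Gaussian vectors in the eigenbasis. -/

section Law

variable {n : ℕ}

theorem charFun_map_scaledVector (b : OrthonormalBasis (Fin n) ℝ (EuclideanSpace ℝ (Fin n)))
    (σ : Fin n → ℝ) (t : EuclideanSpace ℝ (Fin n)) :
    charFun ((Measure.pi fun _ => gaussianReal 0 1).map (scaledVector b σ)) t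
      = Complex.exp (-((∑ i, σ i ^ 2 * ⟪b i, t⟫ ^ 2 : ℝ) : ℂ) / 2) := by
  have hmeas : Measurable (scaledVector b σ) := by unfold scaledVector; fun_prop
  rw [charFun_apply, integral_map hmeas.aemeasurable
    (Measurable.aestronglyMeasurable (by fun_prop))]
  simp only [scaledVector, sum_inner, real_inner_smul_left, Complex.ofReal_sum, Finset.sum_mul,
    Complex.exp_sum]
  rw [integral_fintype_prod_eq_prod
    (f := fun i (x : ℝ) => Complex.exp ((σ i * x * ⟪b i, t⟫ : ℝ) * Complex.I))]
  have : ∀ i, ∫ x : ℝ, Complex.exp ((σ i * x * ⟪b i, t⟫ : ℝ) * Complex.I) ∂gaussianReal 0 1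
      = Complex.exp (-((σ i ^ 2 * ⟪b i, t⟫ ^ 2 : ℝ) : ℂ) / 2) := by
    intro i
    have h := charFun_gaussianReal (μ := 0) (v := 1) (σ i * ⟪b i, t⟫)
    rw [charFun_apply_real] at h
    have h2 : ∀ x : ℝ, ((σ i * x * ⟪b i, t⟫ : ℝ) : ℂ) * Complex.I
        = ((σ i * ⟪b i, t⟫ : ℝ) : ℂ) * x * Complex.I := by
      intro x; push_cast; ring
    simp_rw [h2]
    rw [h]
    congr 1
    push_cast
    ring
  simp_rw [this]
  rw [← Complex.exp_sum, ← Finset.sum_div, ← Finset.sum_neg_distrib]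

variable {Θ : Matrix (Fin n) (Fin n) ℝ} {ε : ℝ}

theorem posDef_add_smul_one (hΘ : Θ.PosSemidef) (hε : 0 < ε) :
    (Θ + ε • (1 : Matrix (Fin n) (Fin n) ℝ)).PosDef :=
  Matrix.PosDef.posSemidef_add hΘ (Matrix.PosDef.one.smul hε)

theorem dotProduct_inv_mulVec_eq_sum (hΘ : Θ.PosSemidef) (hε : 0 < ε)
    (t : EuclideanSpace ℝ (Fin n)) :
    dotProduct t.ofLp (Matrix.mulVec (Θ + ε • (1 : Matrix (Fin n) (Fin n) ℝ))⁻¹ t.ofLp)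
      = ∑ i, (hΘ.isHermitian.eigenvalues i + ε)⁻¹ * ⟪hΘ.isHermitian.eigenvectorBasis i, t⟫ ^ 2 := by
  set b := hΘ.isHermitian.eigenvectorBasis
  set μ := hΘ.isHermitian.eigenvalues with hμ
  have hM := posDef_add_smul_one hΘ hε
  set S := (Θ + ε • (1 : Matrix (Fin n) (Fin n) ℝ))⁻¹ with hS
  have hpos : ∀ i, 0 < μ i + ε := fun i => by
    have := hΘ.eigenvalues_nonneg i
    linarith
  have hb : ∀ i, Matrix.mulVec S (b i).ofLp = (μ i + ε)⁻¹ • (b i).ofLp := by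
    intro i
    have h1 : Matrix.mulVec (Θ + ε • (1 : Matrix (Fin n) (Fin n) ℝ)) (b i).ofLp
        = (μ i + ε) • (b i).ofLp := by
      rw [Matrix.add_mulVec, Matrix.smul_mulVec, Matrix.one_mulVec, add_smul,
        hΘ.isHermitian.mulVec_eigenvectorBasis]
    have h2 : Matrix.mulVec S ((μ i + ε) • (b i).ofLp) = (b i).ofLp := by
      rw [← h1, Matrix.mulVec_mulVec, hS, Matrix.nonsing_inv_mul _ ((Matrix.isUnit_iff_isUnit_det _).1 hM.isUnit),
        Matrix.one_mulVec]
    rw [Matrix.mulVec_smul] at h2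
    rw [← h2, smul_smul, h2, inv_mul_cancel₀ (hpos i).ne', one_smul]
  have hb' : ∀ i, Matrix.toEuclideanLin S (b i) = (μ i + ε)⁻¹ • b i := fun i =>
    WithLp.ofLp_injective 2 (by simpa using hb i)
  have h3 : dotProduct t.ofLp (Matrix.mulVec S t.ofLp) = ⟪Matrix.toEuclideanLin S t, t⟫ := by
    rw [EuclideanSpace.inner_eq_star_dotProduct]
    simp
  rw [h3]
  conv_lhs => enter [2]; rw [← b.sum_repr' t]
  rw [map_sum, sum_inner]
  refine Finset.sum_congr rfl fun i _ => ?_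
  rw [map_smul, hb', inner_smul_left, inner_smul_left]
  simp; ring

/-- Both characteristic functions are Gaussian, with the same quadratic form once the inverse
covariance is diagonalised. -/
theorem map_scaledVector_eq_multivariateGaussian (hΘ : Θ.PosSemidef) (hε : 0 < ε) :
    (Measure.pi fun _ => gaussianReal 0 1).map
        (scaledVector hΘ.isHermitian.eigenvectorBasis
          fun i => (√(hΘ.isHermitian.eigenvalues i + ε))⁻¹)
      = multivariateGaussian 0 (Θ + ε • (1 : Matrix (Fin n) (Fin n) ℝ))⁻¹ := by
  have hmeas : Measurable (scaledVector hΘ.isHermitian.eigenvectorBasis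
      fun i => (√(hΘ.isHermitian.eigenvalues i + ε))⁻¹) := by unfold scaledVector; fun_prop
  have := Measure.isProbabilityMeasure_map (μ := Measure.pi fun _ : Fin n => gaussianReal 0 1)
    hmeas.aemeasurable
  apply Measure.ext_of_charFun
  ext t
  rw [charFun_map_scaledVector, charFun_multivariateGaussian
    (posDef_add_smul_one hΘ hε).inv.posSemidef, dotProduct_inv_mulVec_eq_sum hΘ hε]
  have : ∀ i, (√(hΘ.isHermitian.eigenvalues i + ε))⁻¹ ^ 2
      = (hΘ.isHermitian.eigenvalues i + ε)⁻¹ := fun i => by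
    rw [inv_pow, Real.sq_sqrt (by have := hΘ.eigenvalues_nonneg i; linarith)]
  simp_rw [this]
  congr 1
  simp; ring

theorem gaussianSamples_eq_map (m : ℕ) (hΘ : Θ.PosSemidef) (hε : 0 < ε) :
    gaussianSamples m (Θ + ε • (1 : Matrix (Fin n) (Fin n) ℝ))⁻¹
      = (gaussianMatrix (Fin m) (Fin n)).map fun g k =>
        scaledVector hΘ.isHermitian.eigenvectorBasis
          (fun i => (√(hΘ.isHermitian.eigenvalues i + ε))⁻¹) (g k) := by
  have hmeas : Measurable (scaledVector hΘ.isHermitian.eigenvectorBasis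
      fun i => (√(hΘ.isHermitian.eigenvalues i + ε))⁻¹) := by unfold scaledVector; fun_prop
  have hlaw := map_scaledVector_eq_multivariateGaussian hΘ hε
  have h := Measure.pi_map_pi (ι := Fin m)
    (μ := fun _ => Measure.pi fun _ : Fin n => gaussianReal 0 1)
    (f := fun _ => scaledVector hΘ.isHermitian.eigenvectorBasis
      fun i => (√(hΘ.isHermitian.eigenvalues i + ε))⁻¹)
    (hμ := fun _ => by rw [hlaw]; infer_instance)
    (fun _ => hmeas.aemeasurable)
  simp_rw [hlaw] at h
  exact h.symm

theorem eigenvectorBasis_mem_euclideanKer (hΘ : Θ.IsHermitian) {i : Fin n}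
    (hi : hΘ.eigenvalues i = 0) : hΘ.eigenvectorBasis i ∈ euclideanKer Θ := by
  rw [euclideanKer, LinearMap.mem_ker]
  apply WithLp.ofLp_injective 2
  simpa [hi] using hΘ.mulVec_eigenvectorBasis i

theorem finrank_euclideanKer (hΘ : Θ.IsHermitian) :
    Module.finrank ℝ (euclideanKer Θ) = Fintype.card {i // hΘ.eigenvalues i = 0} := by
  have h1 := LinearMap.finrank_range_add_finrank_ker (Matrix.toEuclideanLin Θ)
  have h0 : Matrix.toEuclideanLin Θ = Matrix.toLin (PiLp.basisFun 2 ℝ (Fin n))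
      (PiLp.basisFun 2 ℝ (Fin n)) Θ := LinearEquiv.congr_fun (Matrix.toLpLin_eq_toLin 2 2) Θ
  rw [h0, ← Matrix.rank_eq_finrank_range_toLin, hΘ.rank_eq_card_non_zero_eigs, ← h0, finrank_euclideanSpace] at h1
  have h2 := Fintype.card_subtype_compl fun i => hΘ.eigenvalues i = 0
  have h3 := Fintype.card_subtype_le fun i => hΘ.eigenvalues i = 0
  rw [euclideanKer]
  simp only [Fintype.card_fin, ne_eq] at h1 h2 h3 ⊢
  omega

theorem IsMinNonzeroEigenvalue.le_eigenvalues {lam : ℝ} (h : IsMinNonzeroEigenvalue Θ lam)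
    (hΘ : Θ.IsHermitian) {i : Fin n} (hi : hΘ.eigenvalues i ≠ 0) : lam ≤ hΘ.eigenvalues i := by
  refine h.2 ⟨hi, Module.End.hasEigenvalue_of_hasEigenvector
    (x := hΘ.eigenvectorBasis i) ⟨Module.End.mem_eigenspace_iff.2 ?_, ?_⟩⟩
  · apply WithLp.ofLp_injective 2
    simpa using hΘ.mulVec_eigenvectorBasis i
  · exact hΘ.eigenvectorBasis.orthonormal.ne_zero i

theorem toLp_transpose_designMatrix_mulVec {m : ℕ}
    (b : OrthonormalBasis (Fin n) ℝ (EuclideanSpace ℝ (Fin n))) (σ : Fin n → ℝ)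
    (g : Fin m → Fin n → ℝ) (a : Fin m → ℝ) :
    WithLp.toLp 2 (Matrix.mulVec (Matrix.transpose
      (designMatrix fun k => scaledVector b σ (g k))) a) = scaledComb b σ g a := by
  rw [scaledComb_eq_sum]
  ext i
  simp [Matrix.mulVec, dotProduct, designMatrix, mul_comm]

end Law

/-! ### Closeness of the span to the kernel, and the conclusion. -/

section Main

/-- Take `v` to be the part of the combination along the directions with `μ i = 0`. Scaling
multiplies the energy there by exactly `1/ε` and elsewhere by at most `1/lam`, which turns the ratio
`K` into `K * ε / lam`. -/
theorem exists_close_in_span_of_energy_ratio {m n : ℕ} {E : Type*} [NormedAddCommGroup E]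
    [InnerProductSpace ℝ E] (b : OrthonormalBasis (Fin n) ℝ E) {μ : Fin n → ℝ} {ε lam K : ℝ}
    (hε : 0 < ε) (hlam : 0 < lam) (hμ : ∀ i, μ i ≠ 0 → lam ≤ μ i) {g : Fin m → Fin n → ℝ}
    {a : Fin m → ℝ} (hK0 : 0 ≤ K)
    (hg : ∑ j : {i // ¬ μ i = 0}, (∑ k, a k * g k j) ^ 2
      ≤ K * ∑ j : {i // μ i = 0}, (∑ k, a k * g k j) ^ 2)
    {V : Submodule ℝ E} (hV : ∀ i, μ i = 0 → b i ∈ V) :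
    ∃ v ∈ V, ‖scaledComb b (fun i => (√(μ i + ε))⁻¹) g a - v‖ ^ 2
      ≤ K * ε / lam * ‖scaledComb b (fun i => (√(μ i + ε))⁻¹) g a‖ ^ 2 := by
  set σ : Fin n → ℝ := fun i => (√(μ i + ε))⁻¹ with hσ
  set x := scaledComb b σ g a with hx
  refine ⟨∑ j : {i // μ i = 0}, ⟪b j, x⟫ • b j,
    V.sum_mem fun j _ => V.smul_mem _ (hV j j.2), ?_⟩
  have hin : ∀ i, ⟪b i, x⟫ = σ i * ∑ k, a k * g k i := inner_scaledComb b σ g a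
  have h1 : x - ∑ j : {i // μ i = 0}, ⟪b j, x⟫ • b j = ∑ j : {i // ¬ μ i = 0}, ⟪b j, x⟫ • b j := by
    rw [sub_eq_iff_eq_add, add_comm,
      Fintype.sum_subtype_add_sum_subtype (fun i => μ i = 0) fun i => ⟪b i, x⟫ • b i, b.sum_repr']
  have h2 : ‖∑ j : {i // ¬ μ i = 0}, ⟪b j, x⟫ • b j‖ ^ 2
      = ∑ j : {i // ¬ μ i = 0}, ⟪b j, x⟫ ^ 2 := by
    have ho : Orthonormal ℝ fun j : {i // ¬ μ i = 0} => b j :=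
      b.orthonormal.comp _ Subtype.val_injective
    rw [← real_inner_self_eq_norm_sq, ho.inner_sum]
    simp [sq]
  have h3 : ‖x‖ ^ 2 = ∑ j : {i // μ i = 0}, ⟪b j, x⟫ ^ 2 + ∑ j : {i // ¬ μ i = 0}, ⟪b j, x⟫ ^ 2 := by
    rw [Fintype.sum_subtype_add_sum_subtype (fun i => μ i = 0) fun i => ⟪b i, x⟫ ^ 2,
      b.sum_sq_inner_right]
  have h4 : ∑ j : {i // μ i = 0}, ⟪b j, x⟫ ^ 2
      = ε⁻¹ * ∑ j : {i // μ i = 0}, (∑ k, a k * g k j) ^ 2 := by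
    rw [Finset.mul_sum]
    refine Finset.sum_congr rfl fun j _ => ?_
    rw [hin, mul_pow, hσ]
    simp only [j.2, zero_add, inv_pow, Real.sq_sqrt hε.le]
  have h5 : ∑ j : {i // ¬ μ i = 0}, ⟪b j, x⟫ ^ 2
      ≤ lam⁻¹ * ∑ j : {i // ¬ μ i = 0}, (∑ k, a k * g k j) ^ 2 := by
    rw [Finset.mul_sum]
    refine Finset.sum_le_sum fun j _ => ?_
    have hj := hμ j j.2
    rw [hin, mul_pow, hσ]
    simp only [inv_pow]
    rw [Real.sq_sqrt (by linarith)]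
    gcongr
    linarith
  rw [h1, h2]
  set Q := ∑ j : {i // μ i = 0}, (∑ k, a k * g k j) ^ 2
  calc _ ≤ lam⁻¹ * (K * Q) := h5.trans (by gcongr)
    _ = K * ε / lam * (ε⁻¹ * Q) := by field_simp
    _ ≤ _ := by
        rw [h3, h4]
        gcongr
        exact le_add_of_nonneg_right (by positivity)

end Main

theorem mainTheorem8 :
    ∃ c C κ : ℝ, 0 < c ∧ 0 < C ∧ 0 < κ ∧
      ∀ (n m : ℕ) (Θ : Matrix (Fin n) (Fin n) ℝ) (lam ε δ η τ : ℝ),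
        Θ.PosSemidef → IsMinNonzeroEigenvalue Θ lam →
        0 < ε → 0 < δ → 0 < η → 0 < τ →
        C * Real.log (n : ℝ) ≤ (m : ℝ) →
        ε ≤ c * δ ^ 2 * lam / (n : ℝ) →
        2 * m < Module.finrank ℝ (euclideanKer Θ) →
        IsQuantitativelyDense (euclideanKer Θ) δ η τ →
        ∀ (u : EuclideanSpace ℝ (Fin n)) (P : Finset (Fin n)),
          (n : ℝ) - τ ≤ (P.card : ℝ) →
          1 - 4 * (m : ℝ) / (3 * (Module.finrank ℝ (euclideanKer Θ) : ℝ))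
              - Real.exp (-(κ * (m : ℝ))) ≤
            (gaussianSamples m (Θ + ε • (1 : Matrix (Fin n) (Fin n) ℝ))⁻¹).real
              {X | η / 32 * ‖coordRestrict P u‖ ≤
                ⨅ a : Fin m → ℝ,
                  ‖coordRestrict P u -
                    coordRestrict P (WithLp.toLp 2
                      (Matrix.mulVec (Matrix.transpose (designMatrix X)) a))‖} := by
  have hs0 := smallBallConst_pos
  -- The first constant is chosen so that `(4 / smallBallConst) * n * ε / lam ≤ (δ/48)²`, the
  -- closeness required of the test vector argument.
  refine ⟨smallBallConst / (4 * 48 ^ 2), 1, 1, by positivity, one_pos, one_pos, ?_⟩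
  intro n m Θ lam ε δ η τ hΘ hlam hε hδ hη hτ _ hεle hr hdense u P hP
  rcases Nat.eq_zero_or_pos m with rfl | hm
  · simp
  set V := euclideanKer Θ with hVdef
  set r := Module.finrank ℝ V with hrdef
  set b := hΘ.isHermitian.eigenvectorBasis
  set μ := hΘ.isHermitian.eigenvalues with hμ
  set σ : Fin n → ℝ := fun i => (√(μ i + ε))⁻¹ with hσ
  have hcard : r = Fintype.card {i // μ i = 0} := finrank_euclideanKer hΘ.isHermitian
  have hμ0 : ∀ i, 0 ≤ μ i := hΘ.eigenvalues_nonneg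
  have hn : 0 < (n : ℝ) := by
    have h1 : r ≤ n := by simpa using Submodule.finrank_le V
    exact_mod_cast (by omega)
  -- Positivity of `lam` follows from `0 < ε` and the upper bound on `ε`.
  have hlam0 : 0 < lam := by
    by_contra hneg
    have : smallBallConst / (4 * 48 ^ 2) * δ ^ 2 * lam / n ≤ 0 :=
      div_nonpos_of_nonpos_of_nonneg
        (mul_nonpos_of_nonneg_of_nonpos (by positivity) (not_lt.1 hneg)) hn.le
    linarith
  have hV : V ≠ ⊥ := by
    rintro h
    have : r = 0 := by rw [hrdef, h]; simp
    omega
  obtain ⟨z, hz⟩ := hdense.exists_test_vector hδ hη hτ hV hP u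
  set I : Finset (Fin n) := Finset.univ.filter fun i => μ i = 0
  have hIcard : I.card = r := by rw [hcard, Fintype.card_subtype]
  have hI : I.Nonempty := by rw [← Finset.card_pos]; omega
  have hA := exists_close_scaledComb_le (m := m) b σ
    (fun i => inv_pos.2 (Real.sqrt_pos.2 (by have := hμ0 i; linarith))) I hI
    (by
      intro i hi j
      have hi0 : μ i = 0 := (Finset.mem_filter.1 hi).2
      simp only [hσ, hi0, zero_add]
      have := hμ0 j
      gcongr
      linarith) z
  have hB := gaussianMatrix_energy_ratio hm (fun i => μ i = 0) (by omega)
  rw [hIcard] at hA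
  set GA := {g : Fin m → Fin n → ℝ | ∀ a, ‖z‖ / 2 ≤ ‖z - scaledComb b σ g a‖}
  set GB := {g : Fin m → Fin n → ℝ | ∀ a : Fin m → ℝ,
    ∑ j : {i // ¬ μ i = 0}, (∑ k, a k * g k j) ^ 2
      ≤ 4 / smallBallConst * n * ∑ j : {i // μ i = 0}, (∑ k, a k * g k j) ^ 2}
  rw [gaussianSamples_eq_map m hΘ hε]
  have hmeas : Measurable fun (g : Fin m → Fin n → ℝ) k => scaledVector b σ (g k) := by
    unfold scaledVector; fun_prop
  set A := {X : Fin m → EuclideanSpace ℝ (Fin n) | η / 32 * ‖coordRestrict P u‖ ≤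
    ⨅ a : Fin m → ℝ, ‖coordRestrict P u - coordRestrict P (WithLp.toLp 2
      (Matrix.mulVec (Matrix.transpose (designMatrix X)) a))‖}
  have hsub : GA ∩ GB ⊆ (fun (g : Fin m → Fin n → ℝ) k => scaledVector b σ (g k)) ⁻¹' A := by
    rintro g ⟨hgA, hgB⟩
    simp only [A, Set.mem_preimage, Set.mem_ofPred_eq]
    refine le_ciInf fun a => ?_
    rw [toLp_transpose_designMatrix_mulVec]
    obtain ⟨v, hv, hvx⟩ := exists_close_in_span_of_energy_ratio b hε hlam0
      (fun i hi => hlam.le_eigenvalues hΘ.isHermitian hi) (by positivity) (hgB a)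
      (V := V) (fun i hi => eigenvectorBasis_mem_euclideanKer hΘ.isHermitian hi)
    refine hz _ v hv (hgA a) ?_
    rw [← sq_le_sq₀ (norm_nonneg _) (by positivity), mul_pow]
    refine hvx.trans ?_
    gcongr
    rw [div_le_iff₀ hlam0]
    rw [le_div_iff₀ hn] at hεle
    calc 4 / smallBallConst * n * ε = 4 / smallBallConst * (ε * n) := by ring
      _ ≤ 4 / smallBallConst * (smallBallConst / (4 * 48 ^ 2) * δ ^ 2 * lam) := by gcongr
      _ = (δ / 48) ^ 2 * lam := by field_simp
  have h1 : (gaussianMatrix (Fin m) (Fin n)).real (GA ∩ GB)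
      ≤ ((gaussianMatrix (Fin m) (Fin n)).map
          fun (g : Fin m → Fin n → ℝ) k => scaledVector b σ (g k)).real A := by
    have : IsProbabilityMeasure ((gaussianMatrix (Fin m) (Fin n)).map
        fun (g : Fin m → Fin n → ℝ) k => scaledVector b σ (g k)) :=
      Measure.isProbabilityMeasure_map hmeas.aemeasurable
    -- Only the inequality `Measure.le_map_apply` is needed, so `A` need not be shown measurable.
    exact ENNReal.toReal_mono (measure_ne_top _ _)
      ((measure_mono hsub).trans (Measure.le_map_apply hmeas.aemeasurable _))
  have h2 : (1 : ℝ) ≤ (gaussianMatrix (Fin m) (Fin n)).real (GA ∩ GB)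
      + ((gaussianMatrix (Fin m) (Fin n)).real GAᶜ
        + (gaussianMatrix (Fin m) (Fin n)).real GBᶜ) := by
    calc (1 : ℝ) = (gaussianMatrix (Fin m) (Fin n)).real ((GA ∩ GB) ∪ (GAᶜ ∪ GBᶜ)) := by
          rw [← Set.compl_inter, Set.union_compl_self, probReal_univ]
      _ ≤ _ := (measureReal_union_le _ _).trans (by gcongr; exact measureReal_union_le _ _)
  rw [one_mul]
  linarith
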